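/- For an integer $d\ge 1$ let $L_{2d}=2U\oplus\langle -2d\rangle\oplus\langle -6\rangle$, where $U$ is the hyperbolic plane (Gram matrix $\begin{pmatrix}0&1\\1&0\end{pmatrix}$), with canonical bases $\{e_1,f_1\},\{e_2,f_2\}$ of the two copies of $U$, and let $v$ be a generator of the factor $\langle -2d\rangle$. Put $v^*=v/\operatorname{div}(v)\in L_{2d}\otimes\mathbb{Q}$, where $\operatorname{div}(v)$ is the positive generator of the ideal $(v,L_{2d})\subset\mathbb{Z}$. Let $\operatorname{O}^+(L_{2d})$ be the group of isometries of $L_{2d}$ whose real spinor norm is trivial, the spinor norm of a product of reflections $\sigma_{w_1}\cdots\sigma_{w_m}$ being the class of $\prod_i\bigl(-(w_i,w_i)/2\bigr)$ in $\mathbb{R}^*/(\mathbb{R}^*)^2$, and let $$\Gamma_{2d}=\{g\in \operatorname{O}^+(L_{2d})\mid g v^*\equiv v^* \bmod L_{2d}\}.$$ Let $\mathcal{D}_{L_{2d}}$ be the connected component containing $[(e_1+f_1)+i(e_2+f_2)]$ of $$\{[x]\in\mathbb{P}(L_{2d}\otimes\mathbb{C})\mid (x,x)=0,\ (x,\overline{x})>0\},$$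 and let $\mathcal{F}_{L_{2d}}(\Gamma_{2d})=\mathcal{D}_{L_{2d}}/\Gamma_{2d}$, with the quotient topology and with the functions whose pull-backs to $\mathcal{D}_{L_{2d}}$ are holomorphic as its holomorphic functions. Let $p>3$ be a prime, and embed $L_{2p^2}$ isometrically in $L_2$ by the identity on $2U\oplus\langle -6\rangle$ and by $v\mapsto pk$, where $k$ generates the factor $\langle -2\rangle$ of $L_2$. Then: 1. Every element of $\Gamma_{2p^2}$ extends along this embedding to an element of $\Gamma_2$. This makes $\Gamma_{2p^2}$ a subgroup of $\Gamma_2$, and it has finite index $$|\Gamma_2:\Gamma_{2p^2}|\le 2(p^5+p^2).$$ 2. The embedding induces a finite branched covering $$\mathcal{F}_{L_{2p^2}}(\Gamma_{2p^2})\to\mathcal{F}_{L_2}(\Gamma_2),$$ that is, a surjective holomorphic map which is proper with finite fibres and which, outside a nowhere dense analytic subset of the target with nowhere dense preimage, is a topological covering and locally biholomorphic. -/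

import Mathlib

open Matrix Topology
open scoped LinearAlgebra.Projectivization

namespace OrthogonalModular

/-! ### Lattices given by a Gram matrix

A lattice is `ℤⁿ` with the bilinear form of an integral symmetric Gram matrix `G`; its scalar
extension to a commutative ring `R` (such as `ℚ`, `ℝ`, `ℂ`) is `Rⁿ` with the same Gram matrix. -/

section Lattice

variable {n : Type} [Fintype n]

/-- The bilinear form `(x, y)` of the lattice with Gram matrix `G`, extended to `R`. -/
def bil (G : Matrix n n ℤ) {R : Type} [CommRing R] (x y : n → R) : R :=
  x ⬝ᵥ (G.map (Int.cast : ℤ → R) *ᵥ y)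

/-- The reflection `σ_w : x ↦ x - (2 (x, w) / (w, w)) w`. -/
noncomputable def reflect (G : Matrix n n ℤ) (w x : n → ℝ) : n → ℝ :=
  x - (2 * bil G x w / bil G w w) • w

theorem reflect_reflect (G : Matrix n n ℤ) {w : n → ℝ} (hw : bil G w w ≠ 0) (x : n → ℝ) :
    reflect G w (reflect G w x) = x := by
  have h : bil G (reflect G w x) w = - bil G x w := by
    have : bil G (reflect G w x) w =
        bil G x w - (2 * bil G x w / bil G w w) * bil G w w := by
      simp [reflect, bil, sub_dotProduct]
    rw [this]; field_simp; ring
  have h2 : reflect G w (reflect G w x) =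
      reflect G w x - (2 * bil G (reflect G w x) w / bil G w w) • w := rfl
  rw [h2, h]
  ext i
  simp [reflect]
  ring

theorem foldr_reverse_reflect (G : Matrix n n ℤ) (ws : List (n → ℝ))
    (hws : ∀ w ∈ ws, bil G w w ≠ 0) (x : n → ℝ) :
    ws.reverse.foldr (reflect G) (ws.foldr (reflect G) x) = x := by
  induction ws with
  | nil => rfl
  | cons w ws ih =>
    simp only [List.reverse_cons, List.foldr_append, List.foldr_cons, List.foldr_nil]
    rw [reflect_reflect G (hws w (by simp))]
    exact ih fun w' hw' => hws w' (by simp [hw'])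

variable [DecidableEq n]

/-- The orthogonal group `O(L ⊗ R)`. -/
def orthogonal (G : Matrix n n ℤ) (R : Type) [CommRing R] : Subgroup (GL n R) where
  carrier := {g | ∀ x y : n → R,
    bil G ((g : Matrix n n R) *ᵥ x) ((g : Matrix n n R) *ᵥ y) = bil G x y}
  one_mem' := by intro x y; simp
  mul_mem' := by
    intro a b ha hb x y
    simp only [Units.val_mul, ← Matrix.mulVec_mulVec]
    rw [ha, hb]
  inv_mem' := by
    intro a ha x y
    have h := ha (((a⁻¹ : GL n R) : Matrix n n R) *ᵥ x) (((a⁻¹ : GL n R) : Matrix n n R) *ᵥ y)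
    simp only [Matrix.mulVec_mulVec, Units.mul_inv, Matrix.one_mulVec] at h
    exact h.symm

/-- `g` is the product `σ_{w₁} ⋯ σ_{wₘ}` of the reflections in the list of anisotropic vectors
`ws = [w₁, …, wₘ]`. -/
def IsReflectionProduct (G : Matrix n n ℤ) (g : GL n ℝ) (ws : List (n → ℝ)) : Prop :=
  (∀ w ∈ ws, bil G w w ≠ 0) ∧
    ∀ x : n → ℝ, (g : Matrix n n ℝ) *ᵥ x = ws.foldr (reflect G) x

/-- The representative `(-(w₁, w₁) / 2) ⋯ (-(wₘ, wₘ) / 2)` of the real spinor norm of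
`σ_{w₁} ⋯ σ_{wₘ}`; the spinor norm is its class modulo the squares of `ℝˣ`. -/
noncomputable def spinorProduct (G : Matrix n n ℤ) (ws : List (n → ℝ)) : ℝ :=
  (ws.map fun w => -(bil G w w) / 2).prod

/-- `O⁺(L ⊗ ℝ)`, the kernel of the real spinor norm: the isometries that are a product of
reflections whose spinor norm is trivial in `ℝˣ / (ℝˣ)²`, that is, represented by a positive
number. (Every isometry of a non-degenerate real space is a product of reflections, and the spinor
norm does not depend on the product chosen.) -/
noncomputable def orthogonalPlusReal (G : Matrix n n ℤ) : Subgroup (GL n ℝ) where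
  carrier := {g | g ∈ orthogonal G ℝ ∧
    ∃ ws : List (n → ℝ), IsReflectionProduct G g ws ∧ 0 < spinorProduct G ws}
  one_mem' := ⟨one_mem _, [], ⟨by simp, by simp⟩, by simp [spinorProduct]⟩
  mul_mem' := by
    rintro a b ⟨ha, us, ⟨hu, hau⟩, hpu⟩ ⟨hb, ws, ⟨hw, hbw⟩, hpw⟩
    refine ⟨mul_mem ha hb, us ++ ws, ⟨?_, ?_⟩, ?_⟩
    · intro w h
      rcases List.mem_append.1 h with h | h
      exacts [hu w h, hw w h]
    · intro x
      simp only [Units.val_mul, ← Matrix.mulVec_mulVec, List.foldr_append]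
      rw [hbw, hau]
    · simp only [spinorProduct, List.map_append, List.prod_append] at *
      exact mul_pos hpu hpw
  inv_mem' := by
    rintro a ⟨ha, ws, ⟨hw, haw⟩, hp⟩
    refine ⟨inv_mem ha, ws.reverse, ⟨by simpa using hw, ?_⟩, ?_⟩
    · intro x
      have h := foldr_reverse_reflect G ws hw (((a⁻¹ : GL n ℝ) : Matrix n n ℝ) *ᵥ x)
      rw [← haw] at h
      simp only [Matrix.mulVec_mulVec, Units.mul_inv, Matrix.one_mulVec] at h
      exact h.symm
    · simpa [spinorProduct, List.map_reverse, List.prod_reverse] using hp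

/-- `O⁺(L) = O(L) ∩ O⁺(L ⊗ ℝ)`. -/
noncomputable def orthogonalPlus (G : Matrix n n ℤ) : Subgroup (GL n ℤ) :=
  orthogonal G ℤ ⊓ (orthogonalPlusReal G).comap (GeneralLinearGroup.map (Int.castRingHom ℝ))

/-- The divisor `div(x)`: the non-negative generator of the ideal `(x, L)`, which is generated by
the products of `x` with the basis vectors, the coordinates of `G x`. -/
def divisor (G : Matrix n n ℤ) (x : n → ℤ) : ℤ :=
  Finset.univ.gcd (G *ᵥ x)

/-- `x* = x / div(x)`, an element of `L ⊗ ℚ` (in fact of the dual lattice). -/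
def dualVec (G : Matrix n n ℤ) (x : n → ℤ) : n → ℚ :=
  fun i => (x i : ℚ) / (divisor G x : ℚ)

/-- The subgroup of those `g ∈ GL(L)` with `g u ≡ u mod L`, for `u ∈ L ⊗ ℚ`. -/
def fixingModLattice (u : n → ℚ) : Subgroup (GL n ℤ) where
  carrier := {g | ∃ z : n → ℤ,
    (g : Matrix n n ℤ).map (Int.cast : ℤ → ℚ) *ᵥ u = u + fun i => (z i : ℚ)}
  one_mem' := ⟨0, by ext; simp [Matrix.map_one]⟩
  mul_mem' := by
    rintro a b ⟨z, hz⟩ ⟨t, ht⟩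
    refine ⟨z + (a : Matrix n n ℤ) *ᵥ t, ?_⟩
    have h : ((a * b : GL n ℤ) : Matrix n n ℤ).map (Int.cast : ℤ → ℚ) =
        (a : Matrix n n ℤ).map (Int.cast : ℤ → ℚ) * (b : Matrix n n ℤ).map (Int.cast : ℤ → ℚ) := by
      ext i j; simp [Matrix.mul_apply]
    rw [h, ← Matrix.mulVec_mulVec, ht, Matrix.mulVec_add, hz]
    ext i
    simp [Matrix.mulVec, dotProduct, add_assoc]
  inv_mem' := by
    rintro a ⟨z, hz⟩
    refine ⟨-(((a⁻¹ : GL n ℤ) : Matrix n n ℤ) *ᵥ z), ?_⟩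
    have key : ∀ A B : Matrix n n ℤ, A * B = 1 →
        A.map (Int.cast : ℤ → ℚ) * B.map (Int.cast : ℤ → ℚ) = 1 := by
      intro A B h
      ext i j
      have h2 := congrArg (fun M : Matrix n n ℤ => ((M i j : ℤ) : ℚ)) h
      simp only [Matrix.mul_apply, Matrix.one_apply] at h2 ⊢
      push_cast at h2
      simpa using h2
    have h := key _ _ (Units.inv_mul a)
    have h3 := congrArg (fun y => ((a⁻¹ : GL n ℤ) : Matrix n n ℤ).map (Int.cast : ℤ → ℚ) *ᵥ y) hz
    simp only [Matrix.mulVec_mulVec, h, Matrix.one_mulVec, Matrix.mulVec_add] at h3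
    rw [eq_sub_of_add_eq h3.symm]
    ext i
    simp [Matrix.mulVec, dotProduct, sub_eq_add_neg]

/-! ### Period domains -/

/-- Complex projective space carries the quotient topology of `ℂⁿ ∖ {0}`. -/
instance instTopologicalSpaceProjectivization : TopologicalSpace (ℙ ℂ (n → ℂ)) :=
  inferInstanceAs (TopologicalSpace (Quotient (projectivizationSetoid ℂ (n → ℂ))))

/-- `Ω_L = {[x] ∈ ℙ(L ⊗ ℂ) | (x, x) = 0, (x, x̄) > 0}`; the number `(x, x̄)` is real. -/
def Omega (G : Matrix n n ℤ) : Set (ℙ ℂ (n → ℂ)) :=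
  {q | ∃ (x : n → ℂ) (hx : x ≠ 0), q = Projectivization.mk ℂ x hx ∧
    bil G x x = 0 ∧ 0 < (bil G x (star x)).re}

end Lattice

/-! ### The lattices `L_{2d}`, the groups `Γ_{2d}` and the modular varieties `𝓕_{L_{2d}}(Γ_{2d})` -/

/-- The Gram matrix of `L_{2d} = 2U ⊕ ⟨-2d⟩ ⊕ ⟨-6⟩` in the basis `e₁, f₁, e₂, f₂, v, w`, where
`eᵢ, fᵢ` are the canonical bases of the two copies of `U` and `v`, `w` generate `⟨-2d⟩`, `⟨-6⟩`. -/
def gramL (d : ℕ) : Matrix (Fin 6) (Fin 6) ℤ :=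
  !![0, 1, 0, 0, 0, 0;
     1, 0, 0, 0, 0, 0;
     0, 0, 0, 1, 0, 0;
     0, 0, 1, 0, 0, 0;
     0, 0, 0, 0, -2 * (d : ℤ), 0;
     0, 0, 0, 0, 0, -6]

/-- The generator `v` of the factor `⟨-2d⟩` of `L_{2d}`. -/
def vGen : Fin 6 → ℤ := ![0, 0, 0, 0, 1, 0]

/-- `Γ_{2d} = {g ∈ O⁺(L_{2d}) | g v* ≡ v* mod L_{2d}}`. -/
noncomputable def Gam (d : ℕ) : Subgroup (GL (Fin 6) ℤ) :=
  orthogonalPlus (gramL d) ⊓ fixingModLattice (dualVec (gramL d) vGen)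

/-- The vector `(e₁ + f₁) + i (e₂ + f₂)` of `L_{2d} ⊗ ℂ`. -/
noncomputable def baseVec : Fin 6 → ℂ := ![1, 1, Complex.I, Complex.I, 0, 0]

theorem baseVec_ne_zero : baseVec ≠ 0 := fun h => by
  simpa [baseVec] using congrFun h 0

/-- The period domain `𝓓_{L_{2d}}`: the connected component of `Ω_{L_{2d}}` that contains
`[(e₁ + f₁) + i (e₂ + f₂)]` (`Ω` has two components, exchanged by complex conjugation, and the
base point selects one of them simultaneously for all `d`). -/
noncomputable def periodDomain (d : ℕ) : Set (ℙ ℂ (Fin 6 → ℂ)) :=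
  connectedComponentIn (Omega (gramL d)) (Projectivization.mk ℂ baseVec baseVec_ne_zero)

/-- Two points of `𝓓_{L_{2d}}` are equivalent if an element of `Γ_{2d}` maps one to the other. -/
noncomputable def orbitSetoid (d : ℕ) : Setoid (periodDomain d) where
  r q q' := ∃ g ∈ Gam d,
    GeneralLinearGroup.map (Int.castRingHom ℂ) g • (q : ℙ ℂ (Fin 6 → ℂ)) = q'
  iseqv :=
    { refl := fun q => ⟨1, one_mem _, by simp⟩
      symm := by
        rintro q q' ⟨g, hg, h⟩
        refine ⟨g⁻¹, inv_mem hg, ?_⟩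
        rw [← h, map_inv, inv_smul_smul]
      trans := by
        rintro q q' q'' ⟨g, hg, h⟩ ⟨g', hg', h'⟩
        refine ⟨g' * g, mul_mem hg' hg, ?_⟩
        rw [map_mul, mul_smul, h, h'] }

/-- The orthogonal modular variety `𝓕_{L_{2d}}(Γ_{2d}) = 𝓓_{L_{2d}} / Γ_{2d}`. -/
def ModVar (d : ℕ) : Type := Quotient (orbitSetoid d)

/-- The quotient topology. -/
instance instTopologicalSpaceModVar (d : ℕ) : TopologicalSpace (ModVar d) :=
  inferInstanceAs (TopologicalSpace (Quotient (orbitSetoid d)))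

/-- The point of `𝓕_{L_{2d}}(Γ_{2d})` represented by the vector `x` with `[x] ∈ 𝓓_{L_{2d}}`. -/
noncomputable def ModVar.pt (d : ℕ) (x : Fin 6 → ℂ) (hx : x ≠ 0)
    (hD : Projectivization.mk ℂ x hx ∈ periodDomain d) : ModVar d :=
  Quotient.mk (orbitSetoid d) ⟨Projectivization.mk ℂ x hx, hD⟩

/-- The structure sheaf of the complex analytic space `𝓓 / Γ`: a function on (an open set) `U` is
holomorphic if its pull-back to `𝓓` is. The latter is tested on the cone `{x | [x] ∈ 𝓓}` over `𝓓`,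
a complex submanifold of `L ⊗ ℂ`: holomorphic functions on a submanifold are those which, locally,
extend to holomorphic functions of the ambient space. -/
def IsHolomorphicOn (d : ℕ) (U : Set (ModVar d)) (f : ModVar d → ℂ) : Prop :=
  ∀ (x : Fin 6 → ℂ) (hx : x ≠ 0) (hD : Projectivization.mk ℂ x hx ∈ periodDomain d),
    ModVar.pt d x hx hD ∈ U →
    ∃ (W : Set (Fin 6 → ℂ)) (F : (Fin 6 → ℂ) → ℂ), IsOpen W ∧ x ∈ W ∧ DifferentiableOn ℂ F W ∧
      ∀ (y : Fin 6 → ℂ) (hy : y ≠ 0) (hyD : Projectivization.mk ℂ y hy ∈ periodDomain d),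
        y ∈ W → ModVar.pt d y hy hyD ∈ U → F y = f (ModVar.pt d y hy hyD)

/-! ### Finite branched coverings

Here `X` and `Y` are topological spaces with sheaves of holomorphic functions, given by predicates
`HX U h`, `HY U h`: the restriction of `h` to the open set `U` is holomorphic. -/

section Covering

variable {X Y : Type} [TopologicalSpace X] [TopologicalSpace Y]

/-- `T ⊆ Y` is an analytic subset: near each point of `Y` it is the set of common zeros of finitely
many holomorphic functions. -/
def IsAnalyticSubset (HY : Set Y → (Y → ℂ) → Prop) (T : Set Y) : Prop :=
  ∀ y : Y, ∃ U : Set Y, IsOpen U ∧ y ∈ U ∧ ∃ s : Set (Y → ℂ), s.Finite ∧ (∀ h ∈ s, HY U h) ∧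
    T ∩ U = {z | z ∈ U ∧ ∀ h ∈ s, h z = 0}

/-- `f` is biholomorphic near `x`: it restricts to a homeomorphism of an open neighbourhood of `x`
onto an open set which identifies the holomorphic functions. -/
def IsBiholomorphicAt (HX : Set X → (X → ℂ) → Prop) (HY : Set Y → (Y → ℂ) → Prop)
    (f : X → Y) (x : X) : Prop :=
  ∃ e : OpenPartialHomeomorph X Y, x ∈ e.source ∧ Set.EqOn f e e.source ∧
    ∀ W : Set Y, IsOpen W → W ⊆ e.target → ∀ h : Y → ℂ,
      HY W h ↔ HX (e.source ∩ f ⁻¹' W) (h ∘ f)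

/-- A finite branched covering: a finite (that is, proper with finite fibres), surjective
holomorphic map which is a locally biholomorphic topological covering outside a nowhere dense
analytic subset (the branch locus) whose preimage is nowhere dense. -/
structure IsFiniteBranchedCovering (HX : Set X → (X → ℂ) → Prop) (HY : Set Y → (Y → ℂ) → Prop)
    (f : X → Y) : Prop where
  proper : IsProperMap f
  finite_fibres : ∀ y : Y, (f ⁻¹' {y}).Finite
  surjective : Function.Surjective f
  holomorphic : ∀ (U : Set Y) (h : Y → ℂ), IsOpen U → HY U h → HX (f ⁻¹' U) (h ∘ f)
  unbranched : ∃ T : Set Y, IsAnalyticSubset HY T ∧ IsNowhereDense T ∧ IsNowhereDense (f ⁻¹' T) ∧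
    IsCoveringMapOn f Tᶜ ∧ ∀ x : X, f x ∉ T → IsBiholomorphicAt HX HY f x

end Covering

/-- The matrix of the isometric embedding `L_{2p²} → L_2`, `t + a v ↦ t + a p k`, for
`t ∈ 2U ⊕ ⟨-6⟩` and `k` the generator of the factor `⟨-2⟩` of `L_2`. -/
def embMat (p : ℕ) : Matrix (Fin 6) (Fin 6) ℤ := diagonal ![1, 1, 1, 1, (p : ℤ), 1]

end OrthogonalModular

/-! Write E for `embMat p`. Through the embedding, g in `Gam (p ^ 2)` becomes h = E g E⁻¹. The
congruence defining `Gam d` concerns only the column of index 4, which must be that of the identity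
modulo 2d. For d = p² this makes h integral, and h then satisfies the congruence for d = 1.
Conversely, h in `Gam 1` comes from `Gam (p ^ 2)` as soon as h k ≡ k mod p: the relations (h e_j, h
k) = 0 for j ≠ 4 and (h k, h k) = -2 supply the remaining divisibilities (`dvd_row_of_mem_Gam`,
`mem_Gam_of_intertwines`). So the coset of h is determined by h k mod p, a point of the affine
quadric x₀x₁ + x₂x₃ - x₄² - 3x₅² = -1 over 𝔽_p. Five coordinates leave at most two values for x₄, so
the index is at most 2p⁵.

For the covering, E identifies the two period domains, so both varieties are quotients of one space
X = `periodDomain 1`: by G = `domainGroup 1` and by a finite index subgroup H = `coverGroup`. If G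
acts locally finitely on a Hausdorff space, then X/H → X/G is proper with finite fibres, and is a
covering away from the image of `ramification`, the points fixed by an element that acts
nontrivially. It remains to check three facts about the action on X. - Local finiteness
(`isLocallyFiniteAction_domainGroup`): each point of X gives a positive definite majorant of the
lattice form, continuous in the point and compatible with the action. Elements moving a small open
set to meet itself therefore have bounded integral entries. - The ramification is nowhere dense
(`interior_ramification`): X is a connected tube domain, so by the identity theorem an element
fixing an open set acts trivially. - Its image is analytic (`isAnalyticSubset_ramification`): near a
point it is cut out by products of fixed-point equations, made invariant under the finite
stabilizer. Slices on which the quotient maps are injective then give the local biholomorphisms. -/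

namespace OrthogonalModular

/-! ### Quotients of a topological space by a locally finite group action -/

section GroupQuotient

set_option linter.unusedSectionVars false

/-- A map which is evenly covered by the disjoint open sheets `W i`. -/
theorem isEvenlyCovered_of_sheets {E B I : Type*} [TopologicalSpace E] [TopologicalSpace B]
    {f : E → B} (hf : Continuous f) (ho : IsOpenMap f) {y : B} {U : Set B} (hU : IsOpen U)
    (hy : y ∈ U) (W : I → Set E) (hW : ∀ i, IsOpen (W i)) (hinj : ∀ i, Set.InjOn f (W i))
    (himg : ∀ i, f '' W i = U) (huniq : ∀ e, f e ∈ U → ∃! i, e ∈ W i) :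
    IsEvenlyCovered f y (f ⁻¹' {y}) := by
  classical
  have hWU : ∀ {i e}, e ∈ W i → f e ∈ U := fun {i e} h => himg i ▸ Set.mem_image_of_mem f h
  choose σ hσ hσ' using fun e : f ⁻¹' U => huniq e e.2
  have hσW : ∀ {i} {e : f ⁻¹' U}, (e : E) ∈ W i → σ e = i := fun {i e} h => (hσ' e i h).symm
  let _ : TopologicalSpace I := ⊥
  have : DiscreteTopology I := ⟨rfl⟩
  -- The trivialization records the image of a point and the sheet that contains it.
  let F : f ⁻¹' U → U × I := fun e => (⟨f e, e.2⟩, σ e)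
  have hFc : Continuous F := by
    refine Continuous.prodMk (by fun_prop) ?_
    refine continuous_discrete_rng.2 fun i => ?_
    have : (fun e : f ⁻¹' U => σ e) ⁻¹' {i} = Subtype.val ⁻¹' W i := by
      ext e
      exact ⟨fun h => by rw [Set.mem_preimage, ← (h : σ e = i)]; exact hσ e, hσW⟩
    rw [this]
    exact (hW i).preimage continuous_subtype_val
  have hFo : IsOpenMap F := by
    intro O hO
    obtain ⟨O', hO', rfl⟩ := isOpen_induced_iff.1 hO
    have : F '' (Subtype.val ⁻¹' O') =
        ⋃ i, (Subtype.val ⁻¹' (f '' (O' ∩ W i)) : Set U) ×ˢ ({i} : Set I) := by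
      ext ⟨u, i⟩
      simp only [Set.mem_image, Set.mem_iUnion, Set.mem_prod, Set.mem_preimage,
        Set.mem_singleton_iff]
      constructor
      · rintro ⟨e, he, h⟩
        obtain ⟨h1, h2⟩ := Prod.ext_iff.1 h
        refine ⟨i, ⟨e, ⟨he, ?_⟩, congrArg Subtype.val h1⟩, rfl⟩
        rw [← show σ e = i from h2]; exact hσ e
      · rintro ⟨j, ⟨e, ⟨he, hej⟩, heu⟩, rfl⟩
        exact ⟨⟨e, hWU hej⟩, he, Prod.ext (Subtype.ext heu) (hσW hej)⟩
    rw [this]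
    exact isOpen_iUnion fun i => ((ho _ (hO'.inter (hW i))).preimage
      continuous_subtype_val).prod (isOpen_discrete _)
  have hFb : Function.Bijective F := by
    constructor
    · intro a b h
      obtain ⟨h1, h2⟩ := Prod.ext_iff.1 h
      refine Subtype.ext (hinj (σ a) (hσ a) ?_ (congrArg Subtype.val h1))
      rw [show σ a = σ b from h2]
      exact hσ b
    · rintro ⟨⟨u, hu⟩, i⟩
      rw [← himg i] at hu
      obtain ⟨e, he, rfl⟩ := hu
      exact ⟨⟨e, hWU he⟩, Prod.ext rfl (hσW he)⟩
  refine IsEvenlyCovered.to_isEvenlyCovered_preimage (I := I)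
    ⟨inferInstance, U, hy, hU, hU.preimage hf,
      (Equiv.ofBijective F hFb).toHomeomorphOfContinuousOpen hFc hFo, fun x => rfl⟩

variable {G X Y Y' : Type*} [Group G] [MulAction G X] [TopologicalSpace X]
  [TopologicalSpace Y] [TopologicalSpace Y']

/-- `π` is a topological quotient map by the action of the subgroup `H`. -/
structure IsQuotientBy (H : Subgroup G) (π : X → Y) : Prop where
  isQuotientMap : IsQuotientMap π
  eq_iff : ∀ x y, π x = π y ↔ ∃ h ∈ H, h • x = y

variable (G X) in
/-- Every point has a neighbourhood that meets only finitely many of its translates. -/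
def IsLocallyFiniteAction : Prop :=
  ∀ x : X, ∃ V : Set X, IsOpen V ∧ x ∈ V ∧ {g : G | ∃ v ∈ V, g • v ∈ V}.Finite

variable (G X) in
/-- The points with a stabilizer that acts nontrivially. -/
def ramification : Set X := {x | ∃ g : G, g • x = x ∧ ∃ y : X, g • y ≠ y}

/-- A neighbourhood of `x` which is stable under the stabilizer of `x` and disjoint from its
translates by other group elements. -/
structure IsSliceAt (G : Type*) [Group G] [MulAction G X] (x : X) (V : Set X) : Prop where
  isOpen : IsOpen V
  mem : x ∈ V
  smul_mem : ∀ g : G, g • x = x → ∀ v ∈ V, g • v ∈ V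
  smul_eq : ∀ g : G, ∀ v ∈ V, g • v ∈ V → g • x = x
  finite : {g : G | g • x = x}.Finite

variable [ContinuousConstSMul G X]

/-- Only the finitely many elements of F can bring the initial neighbourhood back to itself. Those
that move x are excluded by separating x from its image; intersecting the translates under the
finite stabilizer then makes the neighbourhood stable. -/
theorem IsLocallyFiniteAction.exists_isSliceAt [T2Space X] (hG : IsLocallyFiniteAction G X)
    (x : X) {O : Set X} (hO : IsOpen O) (hx : x ∈ O) : ∃ V ⊆ O, IsSliceAt G x V := by
  obtain ⟨V₀, hV₀, hxV₀, hfin⟩ := hG x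
  set F := {g : G | ∃ v ∈ V₀, g • v ∈ V₀} with hF
  have hstab : {g : G | g • x = x} ⊆ F := fun g hg => ⟨x, hxV₀, by rw [hg]; exact hxV₀⟩
  have hsep : ∀ g : G, ∃ A : Set X, IsOpen A ∧ x ∈ A ∧
      (g • x ≠ x → ∀ v ∈ A, g • v ∉ A) := by
    intro g
    by_cases hg : g • x = x
    · exact ⟨Set.univ, isOpen_univ, trivial, fun h => absurd hg h⟩
    · obtain ⟨A, B, hA, hB, hxA, hxB, hAB⟩ := t2_separation (Ne.symm hg)
      refine ⟨A ∩ (g • ·) ⁻¹' B, hA.inter (hB.preimage (continuous_const_smul g)), ⟨hxA, hxB⟩,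
        fun _ v hv hgv => Set.disjoint_left.1 hAB hgv.1 hv.2⟩
  choose A hA hxA hAsep using hsep
  have hSfin := hfin.subset hstab
  let V₁ : Set X := (V₀ ∩ O) ∩ ⋂ g ∈ F, A g
  have hV₁ : IsOpen V₁ := (hV₀.inter hO).inter (hfin.isOpen_biInter fun g _ => hA g)
  have hxV₁ : x ∈ V₁ := ⟨⟨hxV₀, hx⟩, Set.mem_iInter₂.2 fun g _ => hxA g⟩
  let V : Set X := ⋂ s ∈ {g : G | g • x = x}, (s • ·) ⁻¹' V₁
  have hVV₁ : V ⊆ V₁ := fun v hv => by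
    simpa using Set.mem_iInter₂.1 hv 1 (one_smul G x)
  refine ⟨V, fun v hv => (hVV₁ hv).1.2, hSfin.isOpen_biInter fun g _ =>
    hV₁.preimage (continuous_const_smul g), Set.mem_iInter₂.2 fun g hg => ?_, ?_, ?_, hSfin⟩
  · rw [Set.mem_preimage, show g • x = x from hg]; exact hxV₁
  · intro g hg v hv
    refine Set.mem_iInter₂.2 fun s hs => ?_
    have : (s * g) • x = x := by rw [mul_smul, hg, hs]
    simpa [mul_smul] using Set.mem_iInter₂.1 hv (s * g) this
  · intro g v hv hgv
    by_contra hne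
    have hv1 := hVV₁ hv
    have hgv1 := hVV₁ hgv
    have hgF : g ∈ F := ⟨v, hv1.1.1, hgv1.1.1⟩
    exact hAsep g hne v (Set.mem_iInter₂.1 hv1.2 g hgF) (Set.mem_iInter₂.1 hgv1.2 g hgF)

theorem IsQuotientBy.isOpenMap {H : Subgroup G} {π : X → Y} (hπ : IsQuotientBy H π) :
    IsOpenMap π := by
  intro O hO
  rw [← hπ.isQuotientMap.isOpen_preimage]
  have : π ⁻¹' (π '' O) = ⋃ h : H, ((h : G) • ·) ⁻¹' O := by
    ext x
    simp only [Set.mem_preimage, Set.mem_image, Set.mem_iUnion]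
    constructor
    · rintro ⟨y, hy, hyx⟩
      obtain ⟨h, hh, rfl⟩ := (hπ.eq_iff x y).1 hyx.symm
      exact ⟨⟨h, hh⟩, hy⟩
    · rintro ⟨h, hx⟩
      exact ⟨(h : G) • x, hx, ((hπ.eq_iff _ _).2 ⟨h, h.2, rfl⟩).symm⟩
  rw [this]
  exact isOpen_iUnion fun h => hO.preimage (continuous_const_smul _)

theorem smul_mem_ramification {x : X} (g : G) (hx : x ∈ ramification G X) :
    g • x ∈ ramification G X := by
  obtain ⟨k, hk, y, hy⟩ := hx
  refine ⟨g * k * g⁻¹, by simp [mul_smul, hk], g • y, ?_⟩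
  simpa [mul_smul] using hy

theorem preimage_image_ramification {π : X → Y} (hπ : IsQuotientBy (⊤ : Subgroup G) π) :
    π ⁻¹' (π '' ramification G X) = ramification G X := by
  refine Set.Subset.antisymm ?_ (Set.subset_preimage_image _ _)
  rintro x ⟨y, hy, hyx⟩
  obtain ⟨g, -, rfl⟩ := (hπ.eq_iff y x).1 hyx
  exact smul_mem_ramification g hy

/-- Inside a slice only the finite stabilizer of x can fix a point, so the ramification is locally a
finite union of fixed-point sets. Closedness, empty interior and analyticity all rest on this. -/
theorem IsSliceAt.inter_ramification {x : X} {V : Set X} (hV : IsSliceAt G x V) :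
    V ∩ ramification G X =
      V ∩ ⋃ g ∈ {g : G | g • x = x ∧ ∃ y : X, g • y ≠ y}, {v | g • v = v} := by
  ext v
  simp only [Set.mem_inter_iff, Set.mem_iUnion, Set.mem_ofPred_eq, exists_prop, ramification]
  refine and_congr_right fun hv => ⟨?_, ?_⟩
  · rintro ⟨g, hg, hy⟩
    exact ⟨g, ⟨hV.smul_eq g v hv (by rw [hg]; exact hv), hy⟩, hg⟩
  · rintro ⟨g, ⟨-, hy⟩, hg⟩
    exact ⟨g, hg, hy⟩

theorem isClosed_biUnion_fixed [T2Space X] {S : Set G} (hS : S.Finite) :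
    IsClosed (⋃ g ∈ S, {v : X | g • v = v}) :=
  hS.isClosed_biUnion fun g _ => isClosed_eq (continuous_const_smul g) continuous_id

theorem isClosed_ramification [T2Space X] (hG : IsLocallyFiniteAction G X) :
    IsClosed (ramification G X) := by
  rw [← isOpen_compl_iff, isOpen_iff_forall_mem_open]
  intro x hx
  obtain ⟨V, -, hV⟩ := hG.exists_isSliceAt x isOpen_univ trivial
  have hfin : {g : G | g • x = x ∧ ∃ y : X, g • y ≠ y}.Finite := hV.finite.subset fun g hg => hg.1
  have hcl := isClosed_biUnion_fixed (X := X) hfin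
  refine ⟨V \ _, ?_, hV.isOpen.sdiff hcl, hV.mem, ?_⟩
  · rintro v ⟨hv, hv'⟩ hvr
    have := hV.inter_ramification.subset ⟨hv, hvr⟩
    exact hv' this.2
  · intro h
    exact hx (hV.inter_ramification.superset ⟨hV.mem, h⟩).2

theorem interior_biUnion_eq_empty {ι : Type*} {S : Set ι} (hS : S.Finite) (C : ι → Set X)
    (hC : ∀ i ∈ S, IsClosed (C i)) (hi : ∀ i ∈ S, interior (C i) = ∅) :
    interior (⋃ i ∈ S, C i) = ∅ := by
  induction S, hS using Set.Finite.induction_on with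
  | empty => simp
  | @insert a s _ _ ih =>
    rw [Set.biUnion_insert, interior_union_isClosed_of_interior_empty (hC a (by simp))]
    · exact hi a (by simp)
    · exact ih (fun i h => hC i (by simp [h])) fun i h => hi i (by simp [h])

theorem interior_ramification [T2Space X] (hG : IsLocallyFiniteAction G X)
    (hfix : ∀ g : G, (∃ y : X, g • y ≠ y) → interior {v : X | g • v = v} = ∅) :
    interior (ramification G X) = ∅ := by
  rw [Set.eq_empty_iff_forall_notMem]
  intro x hx
  obtain ⟨V, hVO, hV⟩ := hG.exists_isSliceAt x isOpen_interior hx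
  have hfin : {g : G | g • x = x ∧ ∃ y : X, g • y ≠ y}.Finite := hV.finite.subset fun g hg => hg.1
  have h := interior_biUnion_eq_empty hfin (fun g => {v : X | g • v = v})
    (fun g _ => isClosed_eq (continuous_const_smul g) continuous_id) fun g hg => hfix g hg.2
  have hsub : V ⊆ ⋃ g ∈ {g : G | g • x = x ∧ ∃ y : X, g • y ≠ y}, {v : X | g • v = v} :=
    fun v hv => (hV.inter_ramification.subset ⟨hv, interior_subset (hVO hv)⟩).2
  have := interior_maximal hsub hV.isOpen hV.mem
  rw [h] at this
  exact this

/-! ### The map between the quotients by a subgroup and by the whole group -/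

variable {H : Subgroup G} {π : X → Y} {π' : X → Y'} {f : Y' → Y}

theorem continuous_of_quotients (hπ : IsQuotientBy (⊤ : Subgroup G) π) (hπ' : IsQuotientBy H π')
    (hf : ∀ x, f (π' x) = π x) : Continuous f :=
  hπ'.isQuotientMap.continuous_iff.2 (by
    rw [show f ∘ π' = π from funext hf]; exact hπ.isQuotientMap.continuous)

theorem surjective_of_quotients (hπ : IsQuotientBy (⊤ : Subgroup G) π)
    (hf : ∀ x, f (π' x) = π x) : Function.Surjective f := fun y => by
  obtain ⟨x, rfl⟩ := hπ.isQuotientMap.surjective y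
  exact ⟨_, hf x⟩

theorem isOpenMap_of_quotients (hπ : IsQuotientBy (⊤ : Subgroup G) π) (hπ' : IsQuotientBy H π')
    (hf : ∀ x, f (π' x) = π x) : IsOpenMap f := by
  intro O hO
  have : f '' O = π '' (π' ⁻¹' O) := by
    rw [← show f ∘ π' = π from funext hf, Set.image_comp,
      Set.image_preimage_eq _ hπ'.isQuotientMap.surjective]
  rw [this]
  exact hπ.isOpenMap _ (hO.preimage hπ'.isQuotientMap.continuous)

theorem exists_finite_transversal (H : Subgroup G) [H.FiniteIndex] :
    ∃ R : Set G, R.Finite ∧ ∀ g : G, ∃ h ∈ H, ∃ r ∈ R, g = h * r := by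
  have : Finite (G ⧸ H) := H.finite_quotient_of_finiteIndex
  -- `G ⧸ H` consists of left cosets, so inverses of representatives serve for the right cosets H r.
  refine ⟨Set.range fun q : G ⧸ H => q.out⁻¹, Set.finite_range _, fun g => ?_⟩
  refine ⟨g * (QuotientGroup.mk g⁻¹ : G ⧸ H).out, ?_, _, ⟨QuotientGroup.mk g⁻¹, rfl⟩, by group⟩
  have h := QuotientGroup.out_eq' (QuotientGroup.mk g⁻¹ : G ⧸ H)
  have := QuotientGroup.eq.1 h.symm
  simpa using this

theorem finite_fibre_of_quotients [H.FiniteIndex] (hπ : IsQuotientBy (⊤ : Subgroup G) π)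
    (hπ' : IsQuotientBy H π') (hf : ∀ x, f (π' x) = π x) (y : Y) : (f ⁻¹' {y}).Finite := by
  obtain ⟨R, hR, hRG⟩ := exists_finite_transversal H
  obtain ⟨x, rfl⟩ := hπ.isQuotientMap.surjective y
  refine (hR.image fun r => π' (r • x)).subset ?_
  intro e he
  obtain ⟨z, rfl⟩ := hπ'.isQuotientMap.surjective e
  rw [Set.mem_preimage, hf, Set.mem_singleton_iff] at he
  obtain ⟨g, -, rfl⟩ := (hπ.eq_iff _ _).1 he.symm
  obtain ⟨h, hh, r, hr, rfl⟩ := hRG g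
  exact ⟨r, hr, (hπ'.eq_iff _ _).2 ⟨h, hh, by rw [mul_smul]⟩⟩

/-- As the fibres are finite, closedness suffices. The preimage in X of the image of a closed set C
is the union of finitely many translates of the preimage of C, one for each coset representative. -/
theorem isProperMap_of_quotients [H.FiniteIndex] (hπ : IsQuotientBy (⊤ : Subgroup G) π)
    (hπ' : IsQuotientBy H π') (hf : ∀ x, f (π' x) = π x) : IsProperMap f := by
  refine isProperMap_iff_isClosedMap_and_compact_fibers.2
    ⟨continuous_of_quotients hπ hπ' hf, ?_, fun y =>
      (finite_fibre_of_quotients hπ hπ' hf y).isCompact⟩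
  intro C hC
  obtain ⟨R, hR, hRG⟩ := exists_finite_transversal H
  rw [← hπ.isQuotientMap.isClosed_preimage]
  have : π ⁻¹' (f '' C) = ⋃ r ∈ R, (r • ·) ⁻¹' (π' ⁻¹' C) := by
    ext x
    simp only [Set.mem_preimage, Set.mem_image, Set.mem_iUnion, exists_prop]
    constructor
    · rintro ⟨e, he, hex⟩
      obtain ⟨z, rfl⟩ := hπ'.isQuotientMap.surjective e
      rw [hf] at hex
      obtain ⟨g, -, rfl⟩ := (hπ.eq_iff _ _).1 hex.symm
      obtain ⟨h, hh, r, hr, rfl⟩ := hRG g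
      refine ⟨r, hr, ?_⟩
      rwa [(hπ'.eq_iff (r • x) ((h * r) • x)).2 ⟨h, hh, by rw [mul_smul]⟩]
    · rintro ⟨r, -, hr⟩
      exact ⟨_, hr, by rw [hf]; exact ((hπ.eq_iff _ _).2 ⟨r, trivial, rfl⟩).symm⟩
  rw [this]
  exact hR.isClosed_biUnion fun r _ =>
    (hC.preimage hπ'.isQuotientMap.continuous).preimage (continuous_const_smul r)

/-- Two points of V with the same image differ by an element that fixes x; as x is unramified, such
an element acts trivially. -/
theorem injOn_of_quotients (hπ : IsQuotientBy (⊤ : Subgroup G) π)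
    (hf : ∀ x, f (π' x) = π x) {x : X} {V : Set X} (hV : IsSliceAt G x V)
    (hx : x ∉ ramification G X) (g : G) : Set.InjOn f (π' '' ((g • ·) '' V)) := by
  rintro _ ⟨_, ⟨v, hv, rfl⟩, rfl⟩ _ ⟨_, ⟨w, hw, rfl⟩, rfl⟩ h
  simp only [hf] at h
  obtain ⟨k, -, hk⟩ := (hπ.eq_iff _ _).1 h
  have hk' : (g⁻¹ * k * g) • v = w := by
    rw [mul_smul, mul_smul, inv_smul_eq_iff]; exact hk
  have hfix := hV.smul_eq _ v hv (hk' ▸ hw)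
  have : (g⁻¹ * k * g) • v = v := by
    by_contra hne
    exact hx ⟨_, hfix, v, hne⟩
  rw [← hk', this]

/-- The sheets over the image of a slice V at x are the images of the translates g V. They are
indexed by the points `π' (g • x)` of the fibre, with one g chosen for each. -/
theorem isCoveringMapOn_of_quotients [T2Space X] (hG : IsLocallyFiniteAction G X)
    (hπ : IsQuotientBy (⊤ : Subgroup G) π) (hπ' : IsQuotientBy H π')
    (hf : ∀ x, f (π' x) = π x) : IsCoveringMapOn f (π '' ramification G X)ᶜ := by
  intro y hy
  obtain ⟨x, rfl⟩ := hπ.isQuotientMap.surjective y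
  have hx : x ∉ ramification G X := fun h => hy ⟨x, h, rfl⟩
  have htriv : ∀ g : G, g • x = x → ∀ v : X, g • v = v := fun g hg v => by
    by_contra hne
    exact hx ⟨g, hg, v, hne⟩
  obtain ⟨V, -, hV⟩ := hG.exists_isSliceAt x isOpen_univ trivial
  have hπg : ∀ (g : G) (v : X), π (g • v) = π v := fun g v =>
    ((hπ.eq_iff _ _).2 ⟨g, trivial, rfl⟩).symm
  refine isEvenlyCovered_of_sheets (continuous_of_quotients hπ hπ' hf)
    (isOpenMap_of_quotients hπ hπ' hf) (hπ.isOpenMap V hV.isOpen)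
    (Set.mem_image_of_mem π hV.mem)
    (I := Set.range fun g : G => π' (g • x))
    (fun i => π' '' (((i.2.choose : G) • ·) '' V)) (fun i => ?_) (fun i => ?_) (fun i => ?_) ?_
  · exact hπ'.isOpenMap _ ((isOpenMap_smul _) V hV.isOpen)
  · exact injOn_of_quotients hπ hf hV hx _
  · rw [← Set.image_comp, show f ∘ π' = π from funext hf, ← Set.image_comp]
    exact Set.image_congr fun v _ => hπg _ v
  · intro e he
    obtain ⟨z, rfl⟩ := hπ'.isQuotientMap.surjective e
    rw [hf] at he
    obtain ⟨v, hv, hvz⟩ := he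
    obtain ⟨g, -, rfl⟩ := (hπ.eq_iff _ _).1 hvz
    -- A sheet is determined by the fibre point it contains: any group element that carries a point
    -- of V to a point of V fixes x, hence acts trivially.
    have key : ∀ k : G, π' (k • x) = π' (g • x) ↔ π' (g • v) ∈ π' '' ((k • ·) '' V) := by
      intro k
      constructor
      · intro h
        obtain ⟨h, hh, hx'⟩ := (hπ'.eq_iff _ _).1 h
        refine ⟨k • v, ⟨v, hv, rfl⟩, (hπ'.eq_iff _ _).2 ⟨h, hh, ?_⟩⟩
        have h1 : (g⁻¹ * h * k) • x = x := by
          rw [mul_smul, mul_smul, hx', inv_smul_smul]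
        have h2 := htriv _ h1 v
        rwa [mul_smul, mul_smul, inv_smul_eq_iff] at h2
      · rintro ⟨_, ⟨w, hw, rfl⟩, hwv⟩
        obtain ⟨h, hh, hx'⟩ := (hπ'.eq_iff _ _).1 hwv
        refine (hπ'.eq_iff _ _).2 ⟨h, hh, ?_⟩
        have h1 : (g⁻¹ * h * k) • w = v := by
          rw [mul_smul, mul_smul, inv_smul_eq_iff]; exact hx'
        have h2 := hV.smul_eq _ w hw (h1 ▸ hv)
        rwa [mul_smul, mul_smul, inv_smul_eq_iff] at h2
    refine ⟨⟨π' (g • x), g, rfl⟩, (key _).1 (Exists.choose_spec (⟨g, rfl⟩ : ∃ k : G, (fun k : G => π' (k • x)) k = π' (g • x))), ?_⟩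
    intro i hi
    have h1 := (key _).2 hi
    have h2 : π' ((i.2.choose : G) • x) = i := i.2.choose_spec
    exact Subtype.ext (h2.symm.trans h1)

/-- Near an unramified point the map between the quotients is a homeomorphism of the images of
a slice. -/
theorem exists_openPartialHomeomorph (hπ : IsQuotientBy (⊤ : Subgroup G) π)
    (hπ' : IsQuotientBy H π') (hf : ∀ x, f (π' x) = π x) {x : X} {V : Set X}
    (hV : IsSliceAt G x V) (hx : x ∉ ramification G X) :
    ∃ e : OpenPartialHomeomorph Y' Y, e.source = π' '' V ∧ e.target = π '' V ∧ ∀ y, e y = f y := by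
  have hinj : Set.InjOn f (π' '' V) := by
    simpa using injOn_of_quotients hπ hf hV hx 1
  have : Nonempty Y' := ⟨π' x⟩
  refine ⟨OpenPartialHomeomorph.ofContinuousOpen (hinj.toPartialEquiv f _)
    (continuous_of_quotients hπ hπ' hf).continuousOn (isOpenMap_of_quotients hπ hπ' hf)
    (hπ'.isOpenMap V hV.isOpen), rfl, ?_, fun y => rfl⟩
  change f '' (π' '' V) = π '' V
  rw [← Set.image_comp, show f ∘ π' = π from funext hf]

end GroupQuotient

/-! ### The embedding of `Γ_{2p²}` in `Γ_2` -/

section Embedding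

theorem map_intCast_mul {n R : Type} [Fintype n] [CommRing R] (A B : Matrix n n ℤ) :
    (A * B).map (Int.cast : ℤ → R) = A.map Int.cast * B.map Int.cast := by
  ext i j; simp [Matrix.mul_apply]

theorem coe_map_intCast {n R : Type} [Fintype n] [DecidableEq n] [CommRing R] (g : GL n ℤ) :
    ((GeneralLinearGroup.map (Int.castRingHom R) g : GL n R) : Matrix n n R) =
      (g : Matrix n n ℤ).map (Int.cast : ℤ → R) := rfl

theorem bil_mulVec {n R : Type} [Fintype n] [CommRing R] (G : Matrix n n ℤ) (A : Matrix n n R)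
    (x y : n → R) :
    bil G (A *ᵥ x) (A *ᵥ y) = x ⬝ᵥ ((Aᵀ * G.map (Int.cast : ℤ → R) * A) *ᵥ y) := by
  rw [bil, ← Matrix.mulVec_mulVec, ← Matrix.mulVec_mulVec, Matrix.dotProduct_mulVec x,
    Matrix.vecMul_transpose]

theorem mem_orthogonal_iff {n R : Type} [Fintype n] [DecidableEq n] [CommRing R]
    (G : Matrix n n ℤ) (g : GL n R) :
    g ∈ orthogonal G R ↔
      (g : Matrix n n R)ᵀ * G.map (Int.cast : ℤ → R) * (g : Matrix n n R) = G.map Int.cast := by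
  change (∀ x y, _) ↔ _
  simp only [bil_mulVec]
  constructor
  · intro h
    ext i j
    have := h (Pi.single i 1) (Pi.single j 1)
    simpa [bil] using this
  · intro h x y
    rw [h, bil]

theorem bil_gramL {R : Type} [CommRing R] (d : ℕ) (x y : Fin 6 → R) :
    bil (gramL d) x y = x 0 * y 1 + x 1 * y 0 + x 2 * y 3 + x 3 * y 2 - 2 * d * (x 4 * y 4) -
      6 * (x 5 * y 5) := by
  simp [bil, gramL, dotProduct, Matrix.mulVec, Fin.sum_univ_six]
  ring

theorem divisor_vGen (d : ℕ) : divisor (gramL d) vGen = 2 * d := by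
  have h : (gramL d) *ᵥ vGen = Pi.single 4 (-2 * (d : ℤ)) := by
    ext i
    fin_cases i <;> simp [gramL, vGen, Matrix.mulVec, dotProduct, Fin.sum_univ_six]
  rw [divisor, h]
  have h2 : (Finset.univ : Finset (Fin 6)).gcd (Pi.single 4 (-2 * (d : ℤ)) : Fin 6 → ℤ) =
      normalize (-2 * (d : ℤ)) := by
    apply dvd_antisymm_of_normalize_eq Finset.normalize_gcd (normalize_idem _)
    · rw [dvd_normalize_iff]
      simpa using Finset.gcd_dvd (f := (Pi.single 4 (-2 * (d : ℤ)) : Fin 6 → ℤ))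
        (Finset.mem_univ (4 : Fin 6))
    · refine Finset.dvd_gcd fun i _ => ?_
      rw [normalize_dvd_iff]
      by_cases hi : i = 4
      · subst hi; simp
      · simp [hi]
  rw [h2, ← Int.abs_eq_normalize, neg_mul, abs_neg]
  exact abs_of_nonneg (by positivity)

/-- Since div(v) = 2d, the vector v* is e₄/(2d), so only the column of index 4 enters. -/
theorem mem_fixingModLattice_iff {d : ℕ} (hd : 0 < d) (g : GL (Fin 6) ℤ) :
    g ∈ fixingModLattice (dualVec (gramL d) vGen) ↔
      ∀ i, (2 * d : ℤ) ∣ (g : Matrix (Fin 6) (Fin 6) ℤ) i 4 - (1 : Matrix (Fin 6) (Fin 6) ℤ) i 4 := by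
  have hd' : (2 * (d : ℚ)) ≠ 0 := by positivity
  have hv : dualVec (gramL d) vGen = Pi.single 4 (1 / (2 * (d : ℚ))) := by
    ext i
    rw [dualVec, divisor_vGen]
    fin_cases i <;> simp [vGen]
  have key : ∀ (i : Fin 6) (t : ℤ),
      ((g : Matrix (Fin 6) (Fin 6) ℤ).map (Int.cast : ℤ → ℚ) *ᵥ dualVec (gramL d) vGen) i =
        (dualVec (gramL d) vGen) i + t ↔
      (g : Matrix (Fin 6) (Fin 6) ℤ) i 4 - (1 : Matrix (Fin 6) (Fin 6) ℤ) i 4 = 2 * d * t := by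
    intro i t
    have h1 : (Pi.single 4 (1 / (2 * (d : ℚ))) : Fin 6 → ℚ) i =
        ((1 : Matrix (Fin 6) (Fin 6) ℤ) i 4 : ℤ) / (2 * (d : ℚ)) := by
      by_cases hi : i = 4
      · subst hi; simp
      · simp [hi]
    rw [hv, Matrix.mulVec_single, h1, ← @Int.cast_inj ℚ]
    simp only [Pi.smul_apply, Matrix.col_apply, Matrix.map_apply, MulOpposite.smul_eq_mul_unop,
      MulOpposite.unop_op]
    push_cast
    rw [mul_one_div, ← sub_eq_iff_eq_add', ← sub_div, div_eq_iff hd', mul_comm (t : ℚ)]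
  constructor
  · rintro ⟨z, hz⟩ i
    exact ⟨z i, (key i (z i)).1 (congrFun hz i)⟩
  · intro h
    choose z hz using h
    exact ⟨z, funext fun i => (key i (z i)).2 (hz i)⟩

/-- The diagonal of `embMat p`. -/
def embDiag (p : ℕ) : Fin 6 → ℤ := ![1, 1, 1, 1, (p : ℤ), 1]

theorem embDiag_of_ne {p : ℕ} {i : Fin 6} (hi : i ≠ 4) : embDiag p i = 1 := by
  fin_cases i <;> simp_all [embDiag]

theorem embDiag_four (p : ℕ) : embDiag p 4 = p := rfl

theorem embDiag_ne_zero {p : ℕ} (hp : p ≠ 0) (i : Fin 6) : embDiag p i ≠ 0 := by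
  fin_cases i <;> simp [embDiag, hp]

theorem mul_embMat_apply {p : ℕ} (A : Matrix (Fin 6) (Fin 6) ℤ) (i j : Fin 6) :
    (A * embMat p) i j = A i j * embDiag p j := Matrix.mul_diagonal _ _ _ _

theorem embMat_mul_apply {p : ℕ} (A : Matrix (Fin 6) (Fin 6) ℤ) (i j : Fin 6) :
    (embMat p * A) i j = embDiag p i * A i j := Matrix.diagonal_mul _ _ _ _

theorem mul_embMat_cancel {p : ℕ} (hp : p ≠ 0) {A B : Matrix (Fin 6) (Fin 6) ℤ}
    (h : A * embMat p = B * embMat p) : A = B := by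
  ext i j
  have := congrFun (congrFun h i) j
  rw [mul_embMat_apply, mul_embMat_apply] at this
  exact mul_right_cancel₀ (embDiag_ne_zero hp j) this

theorem embMat_mul_cancel {p : ℕ} (hp : p ≠ 0) {A B : Matrix (Fin 6) (Fin 6) ℤ}
    (h : embMat p * A = embMat p * B) : A = B := by
  ext i j
  have := congrFun (congrFun h i) j
  rw [embMat_mul_apply, embMat_mul_apply] at this
  exact mul_left_cancel₀ (embDiag_ne_zero hp i) this

theorem embMat_mulVec_apply {R : Type} [CommRing R] (p : ℕ) (x : Fin 6 → R) (i : Fin 6) :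
    ((embMat p).map (Int.cast : ℤ → R) *ᵥ x) i = embDiag p i * x i := by
  have : (embMat p).map (Int.cast : ℤ → R) = diagonal fun i => (embDiag p i : R) := by
    ext a b
    by_cases h : a = b
    · subst h; simp [embMat, embDiag]
    · simp [embMat, h]
  rw [this, Matrix.mulVec_diagonal]

theorem bil_embMat {R : Type} [CommRing R] (p : ℕ) (x y : Fin 6 → R) :
    bil (gramL 1) ((embMat p).map (Int.cast : ℤ → R) *ᵥ x)
      ((embMat p).map (Int.cast : ℤ → R) *ᵥ y) = bil (gramL (p ^ 2)) x y := by
  simp only [bil_gramL, embMat_mulVec_apply, embDiag]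
  simp
  ring

theorem reflect_embMat (p : ℕ) (w x : Fin 6 → ℝ) :
    reflect (gramL 1) ((embMat p).map (Int.cast : ℤ → ℝ) *ᵥ w)
      ((embMat p).map (Int.cast : ℤ → ℝ) *ᵥ x) =
    (embMat p).map (Int.cast : ℤ → ℝ) *ᵥ reflect (gramL (p ^ 2)) w x := by
  simp only [reflect, bil_embMat, Matrix.mulVec_sub, Matrix.mulVec_smul]

theorem foldr_reflect_embMat (p : ℕ) (ws : List (Fin 6 → ℝ)) (x : Fin 6 → ℝ) :
    (ws.map ((embMat p).map (Int.cast : ℤ → ℝ) *ᵥ ·)).foldr (reflect (gramL 1))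
      ((embMat p).map (Int.cast : ℤ → ℝ) *ᵥ x) =
    (embMat p).map (Int.cast : ℤ → ℝ) *ᵥ ws.foldr (reflect (gramL (p ^ 2))) x := by
  induction ws with
  | nil => rfl
  | cons w ws ih => simp only [List.map_cons, List.foldr_cons, ih, reflect_embMat]

theorem spinorProduct_embMat (p : ℕ) (ws : List (Fin 6 → ℝ)) :
    spinorProduct (gramL 1) (ws.map ((embMat p).map (Int.cast : ℤ → ℝ) *ᵥ ·)) =
      spinorProduct (gramL (p ^ 2)) ws := by
  simp only [spinorProduct, List.map_map]
  congr 1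
  exact List.map_congr_left fun w _ => by simp [bil_embMat]

theorem embMat_mulVec_bijective {R : Type} [Field R] [CharZero R] {p : ℕ} (hp : p ≠ 0) :
    Function.Bijective ((embMat p).map (Int.cast : ℤ → R) *ᵥ ·) := by
  have hne : ∀ i, (embDiag p i : R) ≠ 0 := fun i => Int.cast_ne_zero.2 (embDiag_ne_zero hp i)
  constructor
  · intro x y h
    ext i
    have := congrFun h i
    simp only [embMat_mulVec_apply] at this
    exact mul_left_cancel₀ (hne i) this
  · intro y
    refine ⟨fun i => (embDiag p i : R)⁻¹ * y i, ?_⟩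
    ext i
    simp only [embMat_mulVec_apply]
    field_simp [hne i]

/-- `h` and `g` correspond to each other under the embedding of lattices. -/
def Intertwines (p : ℕ) (h g : GL (Fin 6) ℤ) : Prop :=
  (h : Matrix (Fin 6) (Fin 6) ℤ) * embMat p = embMat p * (g : Matrix (Fin 6) (Fin 6) ℤ)

theorem Intertwines.mulVec {p : ℕ} {h g : GL (Fin 6) ℤ} (hg : Intertwines p h g) {R : Type}
    [CommRing R] (x : Fin 6 → R) :
    (h : Matrix (Fin 6) (Fin 6) ℤ).map (Int.cast : ℤ → R) *ᵥ
      ((embMat p).map (Int.cast : ℤ → R) *ᵥ x) =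
    (embMat p).map (Int.cast : ℤ → R) *ᵥ
      ((g : Matrix (Fin 6) (Fin 6) ℤ).map (Int.cast : ℤ → R) *ᵥ x) := by
  rw [Matrix.mulVec_mulVec, Matrix.mulVec_mulVec, ← map_intCast_mul, ← map_intCast_mul, hg]

theorem Intertwines.isReflectionProduct_iff {p : ℕ} (hp : p ≠ 0) {h g : GL (Fin 6) ℤ}
    (hg : Intertwines p h g) (ws : List (Fin 6 → ℝ)) :
    IsReflectionProduct (gramL 1) (GeneralLinearGroup.map (Int.castRingHom ℝ) h)
      (ws.map ((embMat p).map (Int.cast : ℤ → ℝ) *ᵥ ·)) ↔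
    IsReflectionProduct (gramL (p ^ 2)) (GeneralLinearGroup.map (Int.castRingHom ℝ) g) ws := by
  have hE := embMat_mulVec_bijective (R := ℝ) hp
  simp only [IsReflectionProduct, List.forall_mem_map, bil_embMat, coe_map_intCast]
  refine and_congr_right fun _ => ?_
  refine hE.2.forall.trans (forall_congr' fun x => ?_)
  rw [hg.mulVec, foldr_reflect_embMat]
  exact hE.1.eq_iff

theorem Intertwines.mem_orthogonal_iff {p : ℕ} (hp : p ≠ 0) {h g : GL (Fin 6) ℤ}
    (hg : Intertwines p h g) {R : Type} [Field R] [CharZero R] :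
    GeneralLinearGroup.map (Int.castRingHom R) h ∈ orthogonal (gramL 1) R ↔
      GeneralLinearGroup.map (Int.castRingHom R) g ∈ orthogonal (gramL (p ^ 2)) R := by
  have hE := embMat_mulVec_bijective (R := R) hp
  change (∀ x y, _) ↔ (∀ x y, _)
  simp only [coe_map_intCast]
  refine hE.2.forall.trans (forall_congr' fun x => ?_)
  refine hE.2.forall.trans (forall_congr' fun y => ?_)
  rw [hg.mulVec, hg.mulVec, bil_embMat, bil_embMat]

theorem map_mem_orthogonal_iff {n : Type} [Fintype n] [DecidableEq n] (G : Matrix n n ℤ)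
    (g : GL n ℤ) (R : Type) [CommRing R] [CharZero R] :
    GeneralLinearGroup.map (Int.castRingHom R) g ∈ orthogonal G R ↔ g ∈ orthogonal G ℤ := by
  rw [mem_orthogonal_iff, mem_orthogonal_iff, coe_map_intCast,
    ← Matrix.transpose_map, ← map_intCast_mul, ← map_intCast_mul]
  rw [(Matrix.map_injective (Int.cast_injective (α := R))).eq_iff]
  rw [show G.map (Int.cast : ℤ → ℤ) = G from by ext; simp]

/-- Over ℝ the matrix `embMat p` is a bijective isometry. It carries reflections to reflections and
preserves the norms of their vectors, hence the spinor product. -/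
theorem Intertwines.mem_orthogonalPlus_iff {p : ℕ} (hp : p ≠ 0) {h g : GL (Fin 6) ℤ}
    (hg : Intertwines p h g) :
    h ∈ orthogonalPlus (gramL 1) ↔ g ∈ orthogonalPlus (gramL (p ^ 2)) := by
  have hE := embMat_mulVec_bijective (R := ℝ) hp
  have hO : h ∈ orthogonal (gramL 1) ℤ ↔ g ∈ orthogonal (gramL (p ^ 2)) ℤ := by
    rw [← map_mem_orthogonal_iff _ h ℝ, ← map_mem_orthogonal_iff _ g ℝ]
    exact hg.mem_orthogonal_iff hp
  refine and_congr hO (and_congr (hg.mem_orthogonal_iff hp) ?_)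
  constructor
  · rintro ⟨ws, hws, hpos⟩
    obtain ⟨us, rfl⟩ := hE.2.list_map ws
    exact ⟨us, (hg.isReflectionProduct_iff hp us).1 hws, by rwa [spinorProduct_embMat] at hpos⟩
  · rintro ⟨ws, hws, hpos⟩
    exact ⟨_, (hg.isReflectionProduct_iff hp ws).2 hws, by rwa [spinorProduct_embMat]⟩

/-- The conjugate E g E⁻¹ has entries E_i g_ij / E_j, so the divisibilities say that it is integral;
the same for g⁻¹ makes it invertible over ℤ. -/
theorem exists_intertwines_of_dvd {p : ℕ} (hp : p ≠ 0) (g : GL (Fin 6) ℤ)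
    (h1 : ∀ i j, embDiag p j ∣ embDiag p i * (g : Matrix (Fin 6) (Fin 6) ℤ) i j)
    (h2 : ∀ i j, embDiag p j ∣ embDiag p i * ((g⁻¹ : GL (Fin 6) ℤ) : Matrix (Fin 6) (Fin 6) ℤ) i j) :
    ∃ h, Intertwines p h g := by
  choose A hA using h1
  choose B hB using h2
  have hAE : Matrix.of A * embMat p = embMat p * (g : Matrix (Fin 6) (Fin 6) ℤ) := by
    ext i j
    rw [mul_embMat_apply, embMat_mul_apply, hA, mul_comm]; rfl
  have hBE : Matrix.of B * embMat p =
      embMat p * ((g⁻¹ : GL (Fin 6) ℤ) : Matrix (Fin 6) (Fin 6) ℤ) := by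
    ext i j
    rw [mul_embMat_apply, embMat_mul_apply, hB, mul_comm]; rfl
  refine ⟨⟨Matrix.of A, Matrix.of B, mul_embMat_cancel hp ?_, mul_embMat_cancel hp ?_⟩, hAE⟩
  · rw [Matrix.mul_assoc, hBE, ← Matrix.mul_assoc, hAE, Matrix.mul_assoc, Units.mul_inv,
      Matrix.mul_one, Matrix.one_mul]
  · rw [Matrix.mul_assoc, hAE, ← Matrix.mul_assoc, hBE, Matrix.mul_assoc, Units.inv_mul,
      Matrix.mul_one, Matrix.one_mul]

theorem exists_intertwines'_of_dvd {p : ℕ} (hp : p ≠ 0) (h : GL (Fin 6) ℤ)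
    (h1 : ∀ i j, embDiag p i ∣ (h : Matrix (Fin 6) (Fin 6) ℤ) i j * embDiag p j)
    (h2 : ∀ i j, embDiag p i ∣ ((h⁻¹ : GL (Fin 6) ℤ) : Matrix (Fin 6) (Fin 6) ℤ) i j * embDiag p j) :
    ∃ g, Intertwines p h g := by
  choose A hA using h1
  choose B hB using h2
  have hAE : embMat p * Matrix.of A = (h : Matrix (Fin 6) (Fin 6) ℤ) * embMat p := by
    ext i j
    rw [mul_embMat_apply, embMat_mul_apply, hA]; rfl
  have hBE : embMat p * Matrix.of B =
      ((h⁻¹ : GL (Fin 6) ℤ) : Matrix (Fin 6) (Fin 6) ℤ) * embMat p := by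
    ext i j
    rw [mul_embMat_apply, embMat_mul_apply, hB]; rfl
  refine ⟨⟨Matrix.of A, Matrix.of B, embMat_mul_cancel hp ?_, embMat_mul_cancel hp ?_⟩, hAE.symm⟩
  · rw [← Matrix.mul_assoc, hAE, Matrix.mul_assoc, hBE, ← Matrix.mul_assoc, Units.mul_inv,
      Matrix.mul_one, Matrix.one_mul]
  · rw [← Matrix.mul_assoc, hBE, Matrix.mul_assoc, hAE, ← Matrix.mul_assoc, Units.inv_mul,
      Matrix.mul_one, Matrix.one_mul]

theorem Intertwines.apply {p : ℕ} {h g : GL (Fin 6) ℤ} (hg : Intertwines p h g) (i j : Fin 6) :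
    (h : Matrix (Fin 6) (Fin 6) ℤ) i j * embDiag p j =
      embDiag p i * (g : Matrix (Fin 6) (Fin 6) ℤ) i j := by
  rw [← mul_embMat_apply, ← embMat_mul_apply, hg]

theorem mem_Gam_iff {d : ℕ} (hd : 0 < d) (g : GL (Fin 6) ℤ) :
    g ∈ Gam d ↔ g ∈ orthogonalPlus (gramL d) ∧
      ∀ i, (2 * d : ℤ) ∣ (g : Matrix (Fin 6) (Fin 6) ℤ) i 4 -
        (1 : Matrix (Fin 6) (Fin 6) ℤ) i 4 := by
  rw [Gam, Subgroup.mem_inf, mem_fixingModLattice_iff hd]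

theorem dvd_col_of_mem_Gam {p : ℕ} (hp : p ≠ 0) {g : GL (Fin 6) ℤ} (hg : g ∈ Gam (p ^ 2))
    (i j : Fin 6) : embDiag p j ∣ embDiag p i * (g : Matrix (Fin 6) (Fin 6) ℤ) i j := by
  by_cases hj : j = 4
  · subst hj
    by_cases hi : i = 4
    · subst hi; exact dvd_mul_right _ _
    · have := ((mem_Gam_iff (by positivity) g).1 hg).2 i
      rw [Matrix.one_apply_ne hi, sub_zero] at this
      rw [embDiag_of_ne hi, one_mul, embDiag_four]
      exact (Dvd.intro_left (2 * p : ℤ) (by push_cast; ring)).trans this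
  · rw [embDiag_of_ne hj]; exact one_dvd _

theorem exists_intertwines_of_mem_Gam {p : ℕ} (hp : p ≠ 0) {g : GL (Fin 6) ℤ}
    (hg : g ∈ Gam (p ^ 2)) : ∃ h ∈ Gam 1, Intertwines p h g := by
  obtain ⟨h, hhg⟩ := exists_intertwines_of_dvd hp g (dvd_col_of_mem_Gam hp hg)
    (dvd_col_of_mem_Gam hp (inv_mem hg))
  have hg' := (mem_Gam_iff (by positivity) g).1 hg
  refine ⟨h, (mem_Gam_iff one_pos h).2 ⟨(hhg.mem_orthogonalPlus_iff hp).2 hg'.1, fun i => ?_⟩, hhg⟩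
  have h1 := hhg.apply i 4
  have h2 := hg'.2 i
  have hp' : (p : ℤ) ≠ 0 := by exact_mod_cast hp
  rw [embDiag_four] at h1
  by_cases hi : i = 4
  · subst hi
    rw [embDiag_four, mul_comm] at h1
    rw [mul_left_cancel₀ hp' h1]
    exact (Dvd.intro_left ((p : ℤ) ^ 2) (by push_cast; ring)).trans h2
  · rw [embDiag_of_ne hi, one_mul] at h1
    rw [Matrix.one_apply_ne hi, sub_zero] at h2 ⊢
    obtain ⟨t, ht⟩ := h2
    refine ⟨p * t, mul_right_cancel₀ hp' ?_⟩
    rw [h1, ht]; push_cast; ring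

theorem Intertwines.left_unique {p : ℕ} (hp : p ≠ 0) {h h' g : GL (Fin 6) ℤ}
    (hg : Intertwines p h g) (hg' : Intertwines p h' g) : h = h' :=
  Units.ext (mul_embMat_cancel hp (hg.trans hg'.symm))

theorem Intertwines.right_unique {p : ℕ} (hp : p ≠ 0) {h g g' : GL (Fin 6) ℤ}
    (hg : Intertwines p h g) (hg' : Intertwines p h g') : g = g' :=
  Units.ext (embMat_mul_cancel hp (hg.symm.trans hg'))

theorem Intertwines.mul {p : ℕ} {h h' g g' : GL (Fin 6) ℤ}
    (hg : Intertwines p h g) (hg' : Intertwines p h' g') : Intertwines p (h * h') (g * g') := by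
  rw [Intertwines, Units.val_mul, Units.val_mul, Matrix.mul_assoc, hg', ← Matrix.mul_assoc, hg,
    Matrix.mul_assoc]

/-- The embedding `Γ_{2p²} → Γ_2`. -/
noncomputable def gamHom {p : ℕ} (hp : p ≠ 0) : Gam (p ^ 2) →* Gam 1 :=
  MonoidHom.mk' (fun g => ⟨(exists_intertwines_of_mem_Gam hp g.2).choose,
    (exists_intertwines_of_mem_Gam hp g.2).choose_spec.1⟩) fun a b => Subtype.ext <|
      (exists_intertwines_of_mem_Gam hp (a * b).2).choose_spec.2.left_unique hp
        ((exists_intertwines_of_mem_Gam hp a.2).choose_spec.2.mul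
          (exists_intertwines_of_mem_Gam hp b.2).choose_spec.2)

theorem gamHom_intertwines {p : ℕ} (hp : p ≠ 0) (g : Gam (p ^ 2)) :
    Intertwines p (gamHom hp g : GL (Fin 6) ℤ) g :=
  (exists_intertwines_of_mem_Gam hp g.2).choose_spec.2

theorem gamHom_injective {p : ℕ} (hp : p ≠ 0) : Function.Injective (gamHom hp) := fun a b h =>
  Subtype.ext ((gamHom_intertwines hp a).right_unique hp (h ▸ gamHom_intertwines hp b))

/-! ### The image of the embedding and its index -/

theorem gram_relation {d : ℕ} {h : GL (Fin 6) ℤ} (hh : h ∈ orthogonal (gramL d) ℤ) (a b : Fin 6) :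
    bil (gramL d) (fun i => (h : Matrix (Fin 6) (Fin 6) ℤ) i a)
      (fun i => (h : Matrix (Fin 6) (Fin 6) ℤ) i b) = gramL d a b := by
  have := hh (Pi.single a 1) (Pi.single b 1)
  rw [Matrix.mulVec_single_one, Matrix.mulVec_single_one] at this
  refine this.trans ?_
  simp [bil]

/-- Modulo p the column of index 4 is e₄, so (h e_j, h e₄) = 0 reduces to -2 h_4j ≡ 0, and p is odd.
This is the integrality of E⁻¹ h E. -/
theorem dvd_row_of_mem_Gam {p : ℕ} (hp : p.Prime) (hp3 : 3 < p) {h : GL (Fin 6) ℤ}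
    (hh : h ∈ Gam 1)
    (hk : ∀ i, (p : ℤ) ∣ (h : Matrix (Fin 6) (Fin 6) ℤ) i 4 - (1 : Matrix (Fin 6) (Fin 6) ℤ) i 4)
    (i j : Fin 6) : embDiag p i ∣ (h : Matrix (Fin 6) (Fin 6) ℤ) i j * embDiag p j := by
  by_cases hi : i = 4
  · subst hi
    by_cases hj : j = 4
    · subst hj; exact dvd_mul_left _ _
    rw [embDiag_of_ne hj, mul_one, embDiag_four]
    have hrel := gram_relation hh.1.1 j 4
    rw [bil_gramL] at hrel
    have hz : gramL 1 j 4 = 0 := by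
      fin_cases j <;> simp_all [gramL]
    rw [hz] at hrel
    choose t ht using hk
    have h0 := ht 0
    have h1 := ht 1
    have h2 := ht 2
    have h3 := ht 3
    have h4 := ht 4
    have h5 := ht 5
    rw [Matrix.one_apply_ne (by decide), sub_zero] at h0 h1 h2 h3 h5
    rw [Matrix.one_apply_eq, sub_eq_iff_eq_add] at h4
    rw [h0, h1, h2, h3, h4, h5] at hrel
    have hdvd : (p : ℤ) ∣ 2 * (h : Matrix (Fin 6) (Fin 6) ℤ) 4 j := by
      set M := (h : Matrix (Fin 6) (Fin 6) ℤ)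
      refine ⟨M 0 j * t 1 + M 1 j * t 0 + M 2 j * t 3 + M 3 j * t 2 - 2 * M 4 j * t 4 -
        6 * M 5 j * t 5, ?_⟩
      push_cast at hrel
      linear_combination -hrel
    refine (Int.Prime.dvd_mul' hp hdvd).resolve_left fun h2 => ?_
    have := Int.le_of_dvd (by norm_num) h2
    omega
  · rw [embDiag_of_ne hi]; exact one_dvd _

/-- Off the diagonal, g_i4 = p h_i4 and 2p divides h_i4. The diagonal entry c = h_44 is known to be
1 only modulo 2p; the norm of the column improves this to 2p². -/
theorem mem_Gam_of_intertwines {p : ℕ} (hp : p.Prime) (hp3 : 3 < p) {h g : GL (Fin 6) ℤ}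
    (hh : h ∈ Gam 1) (hhg : Intertwines p h g)
    (hk : ∀ i, (p : ℤ) ∣ (h : Matrix (Fin 6) (Fin 6) ℤ) i 4 - (1 : Matrix (Fin 6) (Fin 6) ℤ) i 4) :
    g ∈ Gam (p ^ 2) := by
  have hp0 := hp.ne_zero
  have hp' : (p : ℤ) ≠ 0 := by exact_mod_cast hp0
  have hh' := (mem_Gam_iff one_pos h).1 hh
  have hcop : IsCoprime (2 : ℤ) p := by
    have := (Nat.coprime_primes Nat.prime_two hp).2 (by omega)
    exact_mod_cast Nat.isCoprime_iff_coprime.2 this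
  have h2p : ∀ i, (2 * p : ℤ) ∣
      (h : Matrix (Fin 6) (Fin 6) ℤ) i 4 - (1 : Matrix (Fin 6) (Fin 6) ℤ) i 4 := fun i =>
    hcop.mul_dvd (by simpa using hh'.2 i) (hk i)
  refine (mem_Gam_iff (by positivity) g).2 ⟨(hhg.mem_orthogonalPlus_iff hp0).1 hh'.1, fun i => ?_⟩
  have h1 := hhg.apply i 4
  rw [embDiag_four] at h1
  by_cases hi : i = 4
  · subst hi
    rw [embDiag_four, mul_comm] at h1
    rw [← mul_left_cancel₀ hp' h1]
    have hrel := gram_relation hh.1.1 4 4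
    rw [bil_gramL] at hrel
    choose t ht using id h2p
    have h0 := ht 0
    have h1 := ht 1
    have h2 := ht 2
    have h3 := ht 3
    have h5 := ht 5
    rw [Matrix.one_apply_ne (by decide), sub_zero] at h0 h1 h2 h3 h5
    rw [h0, h1, h2, h3, h5] at hrel
    rw [Matrix.one_apply_eq]
    have h4 := hk 4
    have h4' := h2p 4
    rw [Matrix.one_apply_eq] at h4 h4'
    set c := (h : Matrix (Fin 6) (Fin 6) ℤ) 4 4
    have hG : gramL 1 4 4 = -2 := by simp [gramL]
    rw [hG] at hrel
    -- All other entries of the column are multiples of 2p, so (h k, h k) = -2 gives c² ≡ 1 modulo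
    -- p². As c + 1 ≡ 2 mod p is prime to p, the whole power divides c - 1.
    have hdvd : (p : ℤ) ^ 2 ∣ (c - 1) * (c + 1) := by
      refine ⟨4 * (t 0 * t 1 + t 2 * t 3 - 3 * t 5 ^ 2), ?_⟩
      push_cast at hrel
      linarith
    have hcop' : IsCoprime ((p : ℤ) ^ 2) (c + 1) := by
      refine IsCoprime.pow_left ?_
      refine (Nat.prime_iff_prime_int.1 hp).coprime_iff_not_dvd.2 fun h => ?_
      have := dvd_sub h h4
      rw [show c + 1 - (c - 1) = 2 by ring] at this
      have := Int.le_of_dvd (by norm_num) this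
      omega
    push_cast
    exact (IsCoprime.pow_right hcop).mul_dvd ((Dvd.intro _ rfl).trans h4')
      (hcop'.dvd_of_dvd_mul_right hdvd)
  · rw [embDiag_of_ne hi, one_mul] at h1
    have h2 := h2p i
    rw [Matrix.one_apply_ne hi, sub_zero] at h2 ⊢
    rw [← h1]
    obtain ⟨t, ht⟩ := h2
    exact ⟨t, by rw [ht]; push_cast; ring⟩

theorem mem_range_gamHom {p : ℕ} (hp : p.Prime) (hp3 : 3 < p) {h : Gam 1}
    (hk : ∀ i, (p : ℤ) ∣ ((h : GL (Fin 6) ℤ) : Matrix (Fin 6) (Fin 6) ℤ) i 4 -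
      (1 : Matrix (Fin 6) (Fin 6) ℤ) i 4) :
    h ∈ (gamHom hp.ne_zero).range := by
  have hk' : ∀ i, (p : ℤ) ∣ (((h⁻¹ : Gam 1) : GL (Fin 6) ℤ) : Matrix (Fin 6) (Fin 6) ℤ) i 4 -
      (1 : Matrix (Fin 6) (Fin 6) ℤ) i 4 := by
    intro i
    set A := (((h⁻¹ : Gam 1) : GL (Fin 6) ℤ) : Matrix (Fin 6) (Fin 6) ℤ) with hA
    set B := ((h : GL (Fin 6) ℤ) : Matrix (Fin 6) (Fin 6) ℤ) with hB
    have hAB : A * B = 1 := Units.inv_mul (h : GL (Fin 6) ℤ)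
    have : A i 4 - (1 : Matrix (Fin 6) (Fin 6) ℤ) i 4 = -∑ k, A i k * (B - 1) k 4 := by
      have h1 : (A * (B - 1)) i 4 = ∑ k, A i k * (B - 1) k 4 := Matrix.mul_apply
      rw [← h1, Matrix.mul_sub, hAB, Matrix.mul_one, Matrix.sub_apply]
      ring
    rw [this, dvd_neg]
    exact Finset.dvd_sum fun k _ => (hk k).mul_left _
  obtain ⟨g, hg⟩ := exists_intertwines'_of_dvd hp.ne_zero (h : GL (Fin 6) ℤ)
    (dvd_row_of_mem_Gam hp hp3 h.2 hk) (dvd_row_of_mem_Gam hp hp3 (h⁻¹).2 hk')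
  have hgG := mem_Gam_of_intertwines hp hp3 h.2 hg hk
  exact ⟨⟨g, hgG⟩, Subtype.ext ((gamHom_intertwines hp.ne_zero ⟨g, hgG⟩).left_unique hp.ne_zero hg)⟩

/-- Forgetting the coordinate x₄ has fibres of size at most two, since the equation determines x₄².
-/
theorem card_quadric_le (p : ℕ) [Fact p.Prime] :
    Nat.card {x : Fin 6 → ZMod p // x 0 * x 1 + x 2 * x 3 - x 4 ^ 2 - 3 * x 5 ^ 2 = -1} ≤
      2 * p ^ 5 := by
  classical
  rw [Nat.card_eq_fintype_card, Fintype.card_subtype]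
  set S := Finset.univ.filter fun x : Fin 6 → ZMod p =>
    x 0 * x 1 + x 2 * x 3 - x 4 ^ 2 - 3 * x 5 ^ 2 = -1
  let f : (Fin 6 → ZMod p) → Fin 5 → ZMod p := fun x => x ∘ Fin.succAbove 4
  have key := Finset.card_le_mul_card_image (f := f) S 2 ?_
  · refine key.trans (Nat.mul_le_mul_left _ ?_)
    refine (Finset.card_le_univ _).trans ?_
    simp [ZMod.card]
  · intro a ha
    obtain ⟨x, hx, rfl⟩ := Finset.mem_image.1 ha
    refine (Finset.card_le_card (t := {x, Function.update x 4 (-x 4)}) ?_).trans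
      Finset.card_le_two
    intro y hy
    obtain ⟨hyS, hyx⟩ := Finset.mem_filter.1 hy
    have hx' := (Finset.mem_filter.1 hx).2
    have hy' := (Finset.mem_filter.1 hyS).2
    have h : ∀ i : Fin 6, i ≠ 4 → y i = x i := fun i hi => by
      obtain ⟨j, rfl⟩ := Fin.exists_succAbove_eq hi
      exact congrFun hyx j
    rw [h 0 (by decide), h 1 (by decide), h 2 (by decide), h 3 (by decide), h 5 (by decide)] at hy'
    have hsq : y 4 ^ 2 = x 4 ^ 2 := by linear_combination hx' - hy'
    rw [Finset.mem_insert, Finset.mem_singleton]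
    rcases sq_eq_sq_iff_eq_or_eq_neg.1 hsq with h4 | h4
    · left
      ext i
      by_cases hi : i = 4
      · subst hi; exact h4
      · exact h i hi
    · right
      ext i
      by_cases hi : i = 4
      · subst hi; simp [h4]
      · simp [hi, h i hi]

/-- The class of `h k` modulo `p`. -/
def colMod (p : ℕ) (h : Gam 1) (i : Fin 6) : ZMod p :=
  (((h : GL (Fin 6) ℤ) : Matrix (Fin 6) (Fin 6) ℤ) i 4 : ZMod p)

/-- This is half of the relation (h k, h k) = -2, reduced modulo p. -/
theorem colMod_mem {p : ℕ} (h : Gam 1) :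
    colMod p h 0 * colMod p h 1 + colMod p h 2 * colMod p h 3 - colMod p h 4 ^ 2 -
      3 * colMod p h 5 ^ 2 = -1 := by
  have hrel := gram_relation h.2.1.1 4 4
  rw [bil_gramL, show gramL 1 4 4 = -2 by simp [gramL]] at hrel
  set M := ((h : GL (Fin 6) ℤ) : Matrix (Fin 6) (Fin 6) ℤ)
  have : M 0 4 * M 1 4 + M 2 4 * M 3 4 - M 4 4 ^ 2 - 3 * M 5 4 ^ 2 = -1 := by
    push_cast at hrel
    linarith
  have := congrArg (Int.cast : ℤ → ZMod p) this
  push_cast at this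
  exact this

/-- Applying h⁻¹ to h k ≡ h' k gives h⁻¹ h' k ≡ k mod p, the criterion of `mem_range_gamHom`. Hence
`colMod` separates cosets. -/
theorem mem_range_of_colMod_eq {p : ℕ} (hp : p.Prime) (hp3 : 3 < p) {h h' : Gam 1}
    (heq : colMod p h = colMod p h') : h⁻¹ * h' ∈ (gamHom hp.ne_zero).range := by
  refine mem_range_gamHom hp hp3 fun i => ?_
  set A := (((h⁻¹ : Gam 1) : GL (Fin 6) ℤ) : Matrix (Fin 6) (Fin 6) ℤ) with hA
  set B := ((h : GL (Fin 6) ℤ) : Matrix (Fin 6) (Fin 6) ℤ) with hB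
  set C := ((h' : GL (Fin 6) ℤ) : Matrix (Fin 6) (Fin 6) ℤ) with hC
  have hAB : A * B = 1 := Units.inv_mul (h : GL (Fin 6) ℤ)
  have h1 : (((h⁻¹ * h' : Gam 1) : GL (Fin 6) ℤ) : Matrix (Fin 6) (Fin 6) ℤ) = A * C := rfl
  have h2 : (A * C) i 4 - (1 : Matrix (Fin 6) (Fin 6) ℤ) i 4 = ∑ k, A i k * (C - B) k 4 := by
    have h1 : (A * (C - B)) i 4 = ∑ k, A i k * (C - B) k 4 := Matrix.mul_apply
    rw [← h1, Matrix.mul_sub, hAB, Matrix.sub_apply]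
  rw [h1, h2]
  refine Finset.dvd_sum fun k _ => Dvd.dvd.mul_left ?_ _
  rw [Matrix.sub_apply, ← ZMod.intCast_eq_intCast_iff_dvd_sub]
  exact congrFun heq k

theorem index_range_gamHom {p : ℕ} (hp : p.Prime) (hp3 : 3 < p) :
    (gamHom hp.ne_zero).range.FiniteIndex ∧ (gamHom hp.ne_zero).range.index ≤ 2 * p ^ 5 := by
  have : Fact p.Prime := ⟨hp⟩
  let F : Gam 1 ⧸ (gamHom hp.ne_zero).range →
      {x : Fin 6 → ZMod p // x 0 * x 1 + x 2 * x 3 - x 4 ^ 2 - 3 * x 5 ^ 2 = -1} :=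
    fun q => ⟨colMod p q.out, colMod_mem q.out⟩
  have hF : Function.Injective F := by
    intro a b hab
    rw [← QuotientGroup.out_eq' a, ← QuotientGroup.out_eq' b]
    exact QuotientGroup.eq.2 (mem_range_of_colMod_eq hp hp3 (congrArg Subtype.val hab))
  have hfin : Finite (Gam 1 ⧸ (gamHom hp.ne_zero).range) := Finite.of_injective F hF
  exact ⟨Subgroup.finiteIndex_of_finite_quotient,
    (Nat.card_le_card_of_injective F hF).trans (card_quadric_le p)⟩

end Embedding

/-! ### Projective space -/

section Projective

variable {n : Type}

/-- The saturation of an open set of vectors is the union of its scalar multiples. Openness allows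
continuity at a single point to be tested on vectors. -/
theorem isOpenQuotientMap_projectivization_mk :
    IsOpenQuotientMap fun v : {v : n → ℂ // v ≠ 0} => Projectivization.mk ℂ v.1 v.2 := by
  refine IsOpenQuotientMap.of_isOpenMap_isQuotientMap ?_ isQuotientMap_quotient_mk'
  intro O hO
  refine (isQuotientMap_quotient_mk'
    (s := projectivizationSetoid ℂ (n → ℂ))).isOpen_preimage.1 ?_
  have : (Quotient.mk (projectivizationSetoid ℂ (n → ℂ))) ⁻¹'
      ((fun v : {v : n → ℂ // v ≠ 0} => Projectivization.mk ℂ v.1 v.2) '' O) =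
      ⋃ c : ℂˣ, (fun v : {v : n → ℂ // v ≠ 0} =>
        (⟨c • v.1, (smul_ne_zero_iff_ne c).2 v.2⟩ : {v : n → ℂ // v ≠ 0})) ⁻¹' O := by
    ext v
    simp only [Set.mem_preimage, Set.mem_iUnion]
    constructor
    · rintro ⟨w, hw, hwv⟩
      obtain ⟨c, hc⟩ := (Projectivization.mk_eq_mk_iff ℂ w.1 v.1 w.2 v.2).1 hwv
      refine ⟨c, ?_⟩
      convert hw
    · rintro ⟨c, hc⟩
      exact ⟨_, hc, (Projectivization.mk_eq_mk_iff ℂ _ _ _ _).2 ⟨c, rfl⟩⟩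
  refine this ▸ isOpen_iUnion fun c => hO.preimage ?_
  exact Continuous.subtype_mk (continuous_subtype_val.const_smul c) _

instance instContinuousConstSMulProjectivization [Fintype n] [DecidableEq n] :
    ContinuousConstSMul (GL n ℂ) (ℙ ℂ (n → ℂ)) where
  continuous_const_smul g := by
    rw [← isOpenQuotientMap_projectivization_mk.continuous_comp_iff]
    have : Continuous fun v : {v : n → ℂ // v ≠ 0} =>
        (⟨(g : Matrix n n ℂ) *ᵥ v.1, (smul_ne_zero_iff_ne g).2 v.2⟩ : {v : n → ℂ // v ≠ 0}) :=
      Continuous.subtype_mk (continuous_const.matrix_mulVec continuous_subtype_val) _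
    exact isOpenQuotientMap_projectivization_mk.continuous.comp this

theorem continuous_projectivization_mk {Z : Type*} [TopologicalSpace Z] {s : Z → n → ℂ}
    (hs : Continuous s) (h0 : ∀ z, s z ≠ 0) :
    Continuous fun z => Projectivization.mk ℂ (s z) (h0 z) :=
  isOpenQuotientMap_projectivization_mk.continuous.comp (hs.subtype_mk h0)

/-- The representative of a point of projective space with first coordinate `1`. -/
noncomputable def normalize0 : ℙ ℂ (Fin 6 → ℂ) → Fin 6 → ℂ :=
  Projectivization.lift (fun v => (v.1 0)⁻¹ • v.1) (by
    rintro ⟨a, ha⟩ ⟨b, hb⟩ t (rfl : a = t • b)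
    have ht : t ≠ 0 := fun h => ha (by simp [h])
    ext i
    simp
    field_simp)

theorem normalize0_mk (x : Fin 6 → ℂ) (hx : x ≠ 0) :
    normalize0 (Projectivization.mk ℂ x hx) = (x 0)⁻¹ • x := rfl

theorem continuousAt_normalize0 {x : Fin 6 → ℂ} (hx : x ≠ 0) (h0 : x 0 ≠ 0) :
    ContinuousAt normalize0 (Projectivization.mk ℂ x hx) := by
  refine (isOpenQuotientMap_projectivization_mk.continuousAt_comp_iff (x := ⟨x, hx⟩)).1 ?_
  change ContinuousAt (fun v : {v : Fin 6 → ℂ // v ≠ 0} => (v.1 0)⁻¹ • v.1) ⟨x, hx⟩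
  have h : ContinuousAt (fun v : {v : Fin 6 → ℂ // v ≠ 0} => v.1 0) ⟨x, hx⟩ :=
    ((continuous_apply 0).comp continuous_subtype_val).continuousAt
  exact (h.inv₀ h0).smul continuous_subtype_val.continuousAt

end Projective

/-! ### The period domain as a tube domain -/

section Domain

theorem bil_smul_smul {n R : Type} [Fintype n] [CommRing R] (G : Matrix n n ℤ) (a b : R)
    (x y : n → R) : bil G (a • x) (b • y) = a * b * bil G x y := by
  simp [bil, Matrix.mulVec_smul]
  ring

theorem bil_smul_star {n : Type} [Fintype n] (G : Matrix n n ℤ) (c : ℂ) (x : n → ℂ) :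
    (bil G (c • x) (star (c • x))).re = Complex.normSq c * (bil G x (star x)).re := by
  rw [star_smul, bil_smul_smul, Complex.star_def, Complex.mul_conj, Complex.re_ofReal_mul]

theorem mk_mem_Omega_iff {n : Type} [Fintype n] (G : Matrix n n ℤ) {x : n → ℂ} (hx : x ≠ 0) :
    Projectivization.mk ℂ x hx ∈ Omega G ↔ bil G x x = 0 ∧ 0 < (bil G x (star x)).re := by
  constructor
  · rintro ⟨y, hy, hxy, h1, h2⟩
    obtain ⟨c, rfl⟩ := (Projectivization.mk_eq_mk_iff' ℂ _ _ _ _).1 hxy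
    have hc : c ≠ 0 := fun h => hx (by simp [h])
    refine ⟨by rw [bil_smul_smul, h1, mul_zero], ?_⟩
    rw [bil_smul_star]
    exact mul_pos (Complex.normSq_pos.2 hc) h2
  · rintro ⟨h1, h2⟩
    exact ⟨x, hx, rfl, h1, h2⟩

/-- The tube domain over the cone `b₀ b₁ > d b₂² + 3 b₃²`, `b₀ > 0`. -/
def tube (d : ℕ) : Set (Fin 4 → ℂ) :=
  {z | 0 < (z 0).im ∧ d * (z 2).im ^ 2 + 3 * (z 3).im ^ 2 < (z 0).im * (z 1).im}

/-- The isotropic vector with first coordinate `1` over a point of the tube domain. -/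
noncomputable def tubeLift (d : ℕ) (z : Fin 4 → ℂ) : Fin 6 → ℂ :=
  ![1, -(z 0 * z 1 - d * z 2 ^ 2 - 3 * z 3 ^ 2), z 0, z 1, z 2, z 3]

theorem tubeLift_ne_zero (d : ℕ) (z : Fin 4 → ℂ) : tubeLift d z ≠ 0 := fun h => by
  simpa [tubeLift] using congrFun h 0

theorem continuous_tubeLift (d : ℕ) : Continuous (tubeLift d) := by
  refine continuous_pi fun i => ?_
  fin_cases i <;> simp [tubeLift] <;> fun_prop

theorem isOpen_tube (d : ℕ) : IsOpen (tube d) := by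
  have h1 : IsOpen {z : Fin 4 → ℂ | 0 < (z 0).im} := isOpen_lt (by fun_prop) (by fun_prop)
  have h2 : IsOpen {z : Fin 4 → ℂ |
      d * (z 2).im ^ 2 + 3 * (z 3).im ^ 2 < (z 0).im * (z 1).im} :=
    isOpen_lt (by fun_prop) (by fun_prop)
  exact h1.inter h2

theorem convex_tube (d : ℕ) : Convex ℝ (tube d) := by
  rintro z ⟨h0, h1⟩ w ⟨k0, k1⟩ a b ha hb hab
  have hd : (0 : ℝ) ≤ d := d.cast_nonneg
  simp only [tube, Set.mem_ofPred_eq, Pi.add_apply, Pi.smul_apply, Complex.add_im,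
    Complex.real_smul, Complex.im_ofReal_mul]
  generalize (z 0).im = p at *
  generalize (z 1).im = q at *
  generalize (z 2).im = u at *
  generalize (z 3).im = v at *
  generalize (w 0).im = p' at *
  generalize (w 1).im = q' at *
  generalize (w 2).im = u' at *
  generalize (w 3).im = v' at *
  have hpos : 0 < a * p + b * p' := by
    rcases ha.eq_or_lt with rfl | ha'
    · have : b = 1 := by linarith
      subst this; linarith
    · have := mul_pos ha' h0
      have := mul_nonneg hb k0.le
      linarith
  -- Reversed Cauchy–Schwarz inequality for two vectors of the positive cone of a Lorentzian form.
  have hcross : 2 * (d * (u * u') + 3 * (v * v')) < p * q' + p' * q := by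
    have hpp : 0 < p * p' := mul_pos h0 k0
    have e1 : p' ^ 2 * (d * u ^ 2 + 3 * v ^ 2) < p' ^ 2 * (p * q) :=
      mul_lt_mul_of_pos_left h1 (by positivity)
    have e2 : p ^ 2 * (d * u' ^ 2 + 3 * v' ^ 2) < p ^ 2 * (p' * q') :=
      mul_lt_mul_of_pos_left k1 (by positivity)
    have e3 : 0 ≤ d * (p * u' - p' * u) ^ 2 + 3 * (p * v' - p' * v) ^ 2 := by positivity
    refine lt_of_mul_lt_mul_left (a := p * p') ?_ hpp.le
    nlinarith
  refine ⟨hpos, ?_⟩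
  have hab' : 0 < a ∨ 0 < b := by
    by_contra h
    push Not at h
    linarith
  have f1 : 0 ≤ a * b * (p * q' + p' * q - 2 * (d * (u * u') + 3 * (v * v'))) :=
    mul_nonneg (mul_nonneg ha hb) (by linarith)
  have f2 : 0 < a ^ 2 * (p * q - (d * u ^ 2 + 3 * v ^ 2)) +
      b ^ 2 * (p' * q' - (d * u' ^ 2 + 3 * v' ^ 2)) := by
    have g1 : 0 < p * q - (d * u ^ 2 + 3 * v ^ 2) := by linarith
    have g2 : 0 < p' * q' - (d * u' ^ 2 + 3 * v' ^ 2) := by linarith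
    rcases hab' with h | h <;> positivity
  linarith

theorem bil_tubeLift (d : ℕ) (z : Fin 4 → ℂ) : bil (gramL d) (tubeLift d z) (tubeLift d z) = 0 := by
  rw [bil_gramL]
  simp [tubeLift]
  ring

theorem bil_tubeLift_star (d : ℕ) (z : Fin 4 → ℂ) :
    (bil (gramL d) (tubeLift d z) (star (tubeLift d z))).re =
      4 * ((z 0).im * (z 1).im - (d * (z 2).im ^ 2 + 3 * (z 3).im ^ 2)) := by
  rw [bil_gramL]
  simp [tubeLift, pow_two]
  ring

/-- If x₀ = 0, isotropy gives |x₂x₃| ≤ d|x₄|² + 3|x₅|², which contradicts the positivity of (x, x̄).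
Dividing by x₀ is therefore possible on all of Ω. -/
theorem zero_ne_of_mem_Omega {d : ℕ} {x : Fin 6 → ℂ} (h1 : bil (gramL d) x x = 0)
    (h2 : 0 < (bil (gramL d) x (star x)).re) : x 0 ≠ 0 := by
  intro h0
  rw [bil_gramL, h0] at h1 h2
  have e1 : x 2 * x 3 = d * x 4 ^ 2 + 3 * x 5 ^ 2 := by linear_combination h1 / 2
  have e2 : ‖x 2‖ * ‖x 3‖ ≤ d * ‖x 4‖ ^ 2 + 3 * ‖x 5‖ ^ 2 := by
    rw [← norm_mul, e1]
    refine (norm_add_le _ _).trans ?_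
    simp
  have e3 : (x 2 * star (x 3)).re ≤ ‖x 2‖ * ‖x 3‖ := by
    refine (Complex.re_le_norm _).trans ?_
    simp
  have e4 : ∀ w : ℂ, w * star w = ((‖w‖ ^ 2 : ℝ) : ℂ) := fun w => by
    rw [Complex.star_def, Complex.mul_conj, Complex.normSq_eq_norm_sq]
  simp only [Pi.star_apply, e4, h0, star_zero, zero_mul, mul_zero, zero_add] at h2
  have e5 : (x 3 * star (x 2)).re = (x 2 * star (x 3)).re := by
    simp; ring
  have e6 : (2 * (d : ℂ) * ((‖x 4‖ ^ 2 : ℝ) : ℂ)).re = 2 * d * ‖x 4‖ ^ 2 := by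
    rw [← Complex.ofReal_natCast, ← Complex.ofReal_ofNat, ← Complex.ofReal_mul,
      ← Complex.ofReal_mul, Complex.ofReal_re]
  have e7 : (6 * ((‖x 5‖ ^ 2 : ℝ) : ℂ)).re = 6 * ‖x 5‖ ^ 2 := by
    rw [← Complex.ofReal_ofNat, ← Complex.ofReal_mul, Complex.ofReal_re]
  rw [Complex.sub_re, Complex.sub_re, Complex.add_re, e5, e6, e7] at h2
  linarith

theorem eq_tubeLift {d : ℕ} {x : Fin 6 → ℂ} (h0 : x 0 = 1) (h1 : bil (gramL d) x x = 0) :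
    x = tubeLift d ![x 2, x 3, x 4, x 5] := by
  rw [bil_gramL, h0] at h1
  ext i
  fin_cases i
  · simpa [tubeLift] using h0
  · simp [tubeLift]; linear_combination h1 / 2
  all_goals simp [tubeLift]

/-- In the normalization x₀ = 1, positivity says Im x₂ · Im x₃ > d (Im x₄)² + 3 (Im x₅)² ≥ 0. The
sign of Im x₂ thus never changes on a connected part of Ω. -/
theorem im_ne_zero_of_mem_Omega {d : ℕ} {x : Fin 6 → ℂ} (h1 : bil (gramL d) x x = 0)
    (h2 : 0 < (bil (gramL d) x (star x)).re) :
    ((x 0)⁻¹ * x 2).im ≠ 0 ∧ (0 < ((x 0)⁻¹ * x 2).im →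
      ∃ z ∈ tube d, (x 0)⁻¹ • x = tubeLift d z) := by
  have h0 := zero_ne_of_mem_Omega h1 h2
  set y := (x 0)⁻¹ • x with hy
  have hy0 : y 0 = 1 := by simp [hy, h0]
  have hy1 : bil (gramL d) y y = 0 := by rw [hy, bil_smul_smul, h1, mul_zero]
  have hy2 : 0 < (bil (gramL d) y (star y)).re := by
    rw [hy, bil_smul_star]
    exact mul_pos (Complex.normSq_pos.2 (inv_ne_zero h0)) h2
  have hlift := eq_tubeLift hy0 hy1
  rw [hlift, bil_tubeLift_star] at hy2
  simp only [Matrix.cons_val] at hy2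
  have h2' : (x 0)⁻¹ * x 2 = y 2 := by simp [hy]
  rw [h2']
  have hd : (0 : ℝ) ≤ d := d.cast_nonneg
  have hpos : 0 ≤ d * (y 4).im ^ 2 + 3 * (y 5).im ^ 2 := by positivity
  refine ⟨fun h => ?_, fun h => ⟨_, ⟨by simpa using h, ?_⟩, hlift⟩⟩
  · rw [h] at hy2; linarith
  · simp only [Matrix.cons_val]; linarith

/-- The points of `Ω` of the same sign as the base point. -/
def positiveCone (d : ℕ) : Set (Fin 6 → ℂ) :=
  {x | bil (gramL d) x x = 0 ∧ 0 < (bil (gramL d) x (star x)).re ∧ 0 < ((x 0)⁻¹ * x 2).im}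

theorem tubeLift_mem_positiveCone {d : ℕ} {z : Fin 4 → ℂ} (hz : z ∈ tube d) :
    tubeLift d z ∈ positiveCone d := by
  refine ⟨bil_tubeLift d z, ?_, ?_⟩
  · rw [bil_tubeLift_star]; linarith [hz.2]
  · simpa [tubeLift] using hz.1

theorem baseVec_eq_tubeLift (d : ℕ) : baseVec = tubeLift d ![Complex.I, Complex.I, 0, 0] := by
  ext i
  fin_cases i <;> simp [baseVec, tubeLift]

theorem base_mem_tube (d : ℕ) : (![Complex.I, Complex.I, 0, 0] : Fin 4 → ℂ) ∈ tube d := by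
  simp [tube]

/-- In one direction Im(x₂/x₀) is continuous without zeros on the component and equals 1 at the base
point. In the other, the image of the convex tube is connected and contains the base point. -/
theorem mk_mem_periodDomain_iff {d : ℕ} {x : Fin 6 → ℂ} (hx : x ≠ 0) :
    Projectivization.mk ℂ x hx ∈ periodDomain d ↔ x ∈ positiveCone d := by
  have hbase : Projectivization.mk ℂ baseVec baseVec_ne_zero ∈ Omega (gramL d) := by
    rw [mk_mem_Omega_iff, baseVec_eq_tubeLift d]
    have := tubeLift_mem_positiveCone (base_mem_tube d)
    exact ⟨this.1, this.2.1⟩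
  constructor
  · intro hD
    have hΩ := (mk_mem_Omega_iff _ hx).1 (connectedComponentIn_subset _ _ hD)
    refine ⟨hΩ.1, hΩ.2, ?_⟩
    have hcont : ContinuousOn (fun q => (normalize0 q 2).im) (periodDomain d) := by
      intro q hq
      refine ContinuousAt.continuousWithinAt ?_
      obtain ⟨y, hy, rfl, hy1, hy2⟩ := connectedComponentIn_subset _ _ hq
      have := continuousAt_normalize0 hy (zero_ne_of_mem_Omega hy1 hy2)
      exact Complex.continuous_im.continuousAt.comp
        ((continuous_apply 2).continuousAt.comp this)
    have hconn : IsPreconnected ((fun q => (normalize0 q 2).im) '' periodDomain d) :=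
      isPreconnected_connectedComponentIn.image _ hcont
    by_contra hneg
    have h1 := Set.mem_image_of_mem (fun q => (normalize0 q 2).im) hD
    have h2 := Set.mem_image_of_mem (fun q => (normalize0 q 2).im)
      (mem_connectedComponentIn hbase)
    have hb : (normalize0 (Projectivization.mk ℂ baseVec baseVec_ne_zero) 2).im = 1 := by
      rw [normalize0_mk]; simp [baseVec]
    have h3 : (0 : ℝ) ∈ Set.Icc (normalize0 (Projectivization.mk ℂ x hx) 2).im
        (normalize0 (Projectivization.mk ℂ baseVec baseVec_ne_zero) 2).im :=
      ⟨not_lt.1 hneg, by rw [hb]; norm_num⟩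
    obtain ⟨q, hq, hq0⟩ := hconn.ordConnected.out h1 h2 h3
    obtain ⟨y, hy, rfl, hy1, hy2⟩ := connectedComponentIn_subset _ _ hq
    exact (im_ne_zero_of_mem_Omega hy1 hy2).1 hq0
  · rintro ⟨h1, h2, h3⟩
    obtain ⟨z, hz, hxz⟩ := (im_ne_zero_of_mem_Omega h1 h2).2 h3
    have hsub : (fun z => Projectivization.mk ℂ (tubeLift d z) (tubeLift_ne_zero d z)) '' tube d ⊆
        periodDomain d := by
      refine IsPreconnected.subset_connectedComponentIn ?_ ?_ ?_
      · exact (convex_tube d).isPreconnected.image _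
          (continuous_projectivization_mk (continuous_tubeLift d) _).continuousOn
      · exact ⟨_, base_mem_tube d, (Projectivization.mk_eq_mk_iff' ℂ _ _ _ _).2
          ⟨1, by rw [one_smul, baseVec_eq_tubeLift d]⟩⟩
      · rintro _ ⟨w, hw, rfl⟩
        have := tubeLift_mem_positiveCone hw
        exact (mk_mem_Omega_iff _ _).2 ⟨this.1, this.2.1⟩
    have : Projectivization.mk ℂ x hx = Projectivization.mk ℂ (tubeLift d z)
        (tubeLift_ne_zero d z) := by
      rw [Projectivization.mk_eq_mk_iff']
      exact ⟨x 0, by rw [← hxz, smul_inv_smul₀ (zero_ne_of_mem_Omega h1 h2)]⟩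
    rw [this]
    exact hsub ⟨z, hz, rfl⟩

theorem exists_tubeLift {d : ℕ} {q : ℙ ℂ (Fin 6 → ℂ)} (hq : q ∈ periodDomain d) :
    ∃ z ∈ tube d, normalize0 q = tubeLift d z ∧
      q = Projectivization.mk ℂ (tubeLift d z) (tubeLift_ne_zero d z) := by
  induction q using Projectivization.ind with
  | h x hx =>
    obtain ⟨h1, h2, h3⟩ := (mk_mem_periodDomain_iff hx).1 hq
    obtain ⟨z, hz, hxz⟩ := (im_ne_zero_of_mem_Omega h1 h2).2 h3
    refine ⟨z, hz, hxz, ?_⟩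
    rw [Projectivization.mk_eq_mk_iff']
    exact ⟨x 0, by rw [← hxz, smul_inv_smul₀ (zero_ne_of_mem_Omega h1 h2)]⟩

theorem continuous_normalize0 (d : ℕ) : Continuous fun q : periodDomain d => normalize0 q := by
  refine continuous_iff_continuousAt.2 fun q => ?_
  obtain ⟨z, -, -, hq⟩ := exists_tubeLift q.2
  have := continuousAt_normalize0 (tubeLift_ne_zero d z) (by simp [tubeLift])
  rw [← hq] at this
  exact this.comp continuous_subtype_val.continuousAt

theorem normalize0_injective (d : ℕ) :
    Function.Injective fun q : periodDomain d => normalize0 q := by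
  intro q r h
  obtain ⟨z, -, h1, hq⟩ := exists_tubeLift q.2
  obtain ⟨w, -, h2, hr⟩ := exists_tubeLift r.2
  refine Subtype.ext ?_
  rw [hq, hr]
  congr 1
  rw [← h1, ← h2]
  exact h

instance instT2SpacePeriodDomain (d : ℕ) : T2Space (periodDomain d) :=
  T2Space.of_injective_continuous (normalize0_injective d) (continuous_normalize0 d)

theorem normalize0_ne_zero {d : ℕ} (q : periodDomain d) : normalize0 q ≠ 0 := by
  obtain ⟨z, -, h1, -⟩ := exists_tubeLift q.2
  rw [h1]; exact tubeLift_ne_zero d z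

theorem mk_normalize0_eq {d : ℕ} (q : periodDomain d) :
    Projectivization.mk ℂ _ (normalize0_ne_zero q) = q := by
  obtain ⟨z, -, h1, hq⟩ := exists_tubeLift q.2
  refine Eq.trans ?_ hq.symm
  congr 1

theorem normalize0_mem {d : ℕ} (q : periodDomain d) : (normalize0 q : Fin 6 → ℂ) ∈ positiveCone d := by
  rw [← mk_mem_periodDomain_iff (normalize0_ne_zero q), mk_normalize0_eq]
  exact q.2

end Domain

/-! ### The action of the modular group on the period domain -/

section Action

open scoped Pointwise

/-- The action of an integral matrix on projective space. -/
noncomputable def toGLC : GL (Fin 6) ℤ →* GL (Fin 6) ℂ := GeneralLinearGroup.map (Int.castRingHom ℂ)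

/-- The action of an integral matrix on `ℂ⁶`. -/
noncomputable def actC (g : GL (Fin 6) ℤ) (x : Fin 6 → ℂ) : Fin 6 → ℂ :=
  (g : Matrix (Fin 6) (Fin 6) ℤ).map (Int.cast : ℤ → ℂ) *ᵥ x

theorem actC_mul (g h : GL (Fin 6) ℤ) (x : Fin 6 → ℂ) : actC (g * h) x = actC g (actC h x) := by
  rw [actC, actC, actC, Matrix.mulVec_mulVec, ← map_intCast_mul, Units.val_mul]

theorem actC_one (x : Fin 6 → ℂ) : actC 1 x = x := by
  rw [actC, Units.val_one, Matrix.map_one _ Int.cast_zero Int.cast_one, Matrix.one_mulVec]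

theorem continuous_actC (g : GL (Fin 6) ℤ) : Continuous (actC g) :=
  continuous_const.matrix_mulVec continuous_id

theorem actC_ne_zero {g : GL (Fin 6) ℤ} {x : Fin 6 → ℂ} (hx : x ≠ 0) : actC g x ≠ 0 := fun h => by
  have := actC_mul g⁻¹ g x
  rw [h, inv_mul_cancel, actC_one] at this
  exact hx (this.trans (Matrix.mulVec_zero _))

theorem toGLC_smul_mk (g : GL (Fin 6) ℤ) {x : Fin 6 → ℂ} (hx : x ≠ 0) :
    toGLC g • Projectivization.mk ℂ x hx = Projectivization.mk ℂ (actC g x) (actC_ne_zero hx) := rfl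

theorem star_actC (g : GL (Fin 6) ℤ) (x : Fin 6 → ℂ) : star (actC g x) = actC g (star x) := by
  ext i
  simp [actC, Matrix.mulVec, dotProduct]

theorem bil_actC {d : ℕ} {g : GL (Fin 6) ℤ} (hg : g ∈ orthogonal (gramL d) ℤ)
    (x y : Fin 6 → ℂ) : bil (gramL d) (actC g x) (actC g y) = bil (gramL d) x y :=
  (map_mem_orthogonal_iff _ g ℂ).2 hg x y

theorem smul_mem_Omega {d : ℕ} {g : GL (Fin 6) ℤ} (hg : g ∈ orthogonal (gramL d) ℤ)
    {q : ℙ ℂ (Fin 6 → ℂ)} (hq : q ∈ Omega (gramL d)) : toGLC g • q ∈ Omega (gramL d) := by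
  obtain ⟨x, hx, rfl, h1, h2⟩ := hq
  rw [toGLC_smul_mk, mk_mem_Omega_iff, star_actC, bil_actC hg, bil_actC hg]
  exact ⟨h1, h2⟩

theorem smul_Omega {d : ℕ} {g : GL (Fin 6) ℤ} (hg : g ∈ orthogonal (gramL d) ℤ) :
    (toGLC g • ·) '' Omega (gramL d) = Omega (gramL d) := by
  refine Set.Subset.antisymm ?_ ?_
  · rintro _ ⟨q, hq, rfl⟩
    exact smul_mem_Omega hg hq
  · intro q hq
    refine ⟨toGLC g⁻¹ • q, smul_mem_Omega (inv_mem hg) hq, ?_⟩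
    simp

/-- An isometry acts on Ω by a homeomorphism, so it permutes components, and a single point that
stays in 𝓓 decides. Hence `Gam d` and `domainGroup d` define the same equivalence on 𝓓, with no
appeal to the spinor norm. -/
theorem smul_periodDomain {d : ℕ} {g : GL (Fin 6) ℤ} (hg : g ∈ orthogonal (gramL d) ℤ)
    {q : ℙ ℂ (Fin 6 → ℂ)} (hq : q ∈ periodDomain d) (hgq : toGLC g • q ∈ periodDomain d) :
    toGLC g • periodDomain d = periodDomain d := by
  have hqΩ := connectedComponentIn_subset _ _ hq
  have h := (Homeomorph.smul (toGLC g)).image_connectedComponentIn hqΩ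
  simp only [Homeomorph.smul_apply] at h
  rw [smul_Omega hg] at h
  have h1 : periodDomain d = connectedComponentIn (Omega (gramL d)) q := connectedComponentIn_eq hq
  have h2 : periodDomain d = connectedComponentIn (Omega (gramL d)) (toGLC g • q) :=
    connectedComponentIn_eq hgq
  rw [← h1, ← h2] at h
  exact h

/-- The elements of `Γ_{2d}` that map the period domain to itself. -/
noncomputable def domainGroup (d : ℕ) : Subgroup (GL (Fin 6) ℤ) :=
  Gam d ⊓ (MulAction.stabilizer (GL (Fin 6) ℂ) (periodDomain d)).comap toGLC

theorem mem_domainGroup {d : ℕ} {g : GL (Fin 6) ℤ} (hg : g ∈ Gam d)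
    {q : ℙ ℂ (Fin 6 → ℂ)} (hq : q ∈ periodDomain d) (hgq : toGLC g • q ∈ periodDomain d) :
    g ∈ domainGroup d :=
  ⟨hg, smul_periodDomain hg.1.1 hq hgq⟩

theorem smul_mem_periodDomain {d : ℕ} (g : domainGroup d) (q : periodDomain d) :
    toGLC (g : GL (Fin 6) ℤ) • (q : ℙ ℂ (Fin 6 → ℂ)) ∈ periodDomain d := by
  have h : toGLC (g : GL (Fin 6) ℤ) • periodDomain d = periodDomain d := g.2.2
  exact h.subset (Set.smul_mem_smul_set q.2)

noncomputable instance instMulActionDomainGroup (d : ℕ) :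
    MulAction (domainGroup d) (periodDomain d) where
  smul g q := ⟨toGLC (g : GL (Fin 6) ℤ) • (q : ℙ ℂ (Fin 6 → ℂ)), smul_mem_periodDomain g q⟩
  one_smul q := Subtype.ext (by
    change toGLC ((1 : domainGroup d) : GL (Fin 6) ℤ) • (q : ℙ ℂ (Fin 6 → ℂ)) = q
    simp)
  mul_smul g h q := Subtype.ext (by
    change toGLC ((g * h : domainGroup d) : GL (Fin 6) ℤ) • (q : ℙ ℂ (Fin 6 → ℂ)) =
      toGLC (g : GL (Fin 6) ℤ) • toGLC (h : GL (Fin 6) ℤ) • (q : ℙ ℂ (Fin 6 → ℂ))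
    rw [Subgroup.coe_mul, map_mul, mul_smul])

theorem coe_smul_periodDomain {d : ℕ} (g : domainGroup d) (q : periodDomain d) :
    ((g • q : periodDomain d) : ℙ ℂ (Fin 6 → ℂ)) = toGLC (g : GL (Fin 6) ℤ) • q.1 := rfl

instance instContinuousConstSMulDomainGroup (d : ℕ) :
    ContinuousConstSMul (domainGroup d) (periodDomain d) where
  continuous_const_smul g :=
    ((continuous_const_smul (toGLC (g : GL (Fin 6) ℤ))).comp continuous_subtype_val).subtype_mk _

/-- The projection `𝓓 → 𝓕`. -/
noncomputable def modProj (d : ℕ) (q : periodDomain d) : ModVar d := Quotient.mk (orbitSetoid d) q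

theorem isQuotientBy_modProj (d : ℕ) :
    IsQuotientBy (⊤ : Subgroup (domainGroup d)) (modProj d) where
  isQuotientMap := isQuotientMap_quotient_mk'
  eq_iff q r := by
    refine (Quotient.eq (r := orbitSetoid d)).trans ?_
    constructor
    · rintro ⟨g, hg, h⟩
      exact ⟨⟨g, mem_domainGroup hg q.2 (by erw [h]; exact r.2)⟩, trivial, Subtype.ext h⟩
    · rintro ⟨g, -, h⟩
      exact ⟨g, g.2.1, congrArg Subtype.val h⟩

theorem exists_smul_normalize0 {d : ℕ} (g : domainGroup d) (q : periodDomain d) :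
    ∃ c : ℂ, c ≠ 0 ∧ normalize0 (g • q : periodDomain d) = c • actC g (normalize0 q) := by
  have h : ((g • q : periodDomain d) : ℙ ℂ (Fin 6 → ℂ)) =
      Projectivization.mk ℂ _ (actC_ne_zero (g := (g : GL (Fin 6) ℤ)) (normalize0_ne_zero q)) := by
    rw [coe_smul_periodDomain, ← toGLC_smul_mk _ (normalize0_ne_zero q), mk_normalize0_eq]
  have h' := normalize0_ne_zero (g • q)
  refine ⟨(actC (g : GL (Fin 6) ℤ) (normalize0 q) 0)⁻¹, ?_, by rw [h, normalize0_mk]⟩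
  intro h0
  rw [h, normalize0_mk, h0, zero_smul] at h'
  exact h' rfl

/-! ### Local finiteness -/

/-- The majorant of the lattice form attached to a point of the period domain. -/
noncomputable def majorant (d : ℕ) (x : Fin 6 → ℂ) (u : Fin 6 → ℝ) : ℝ :=
  4 * Complex.normSq (bil (gramL d) x fun i => (u i : ℂ)) / (bil (gramL d) x (star x)).re -
    bil (gramL d) u u

theorem majorant_smul {d : ℕ} (c : ℂ) (hc : c ≠ 0) (x : Fin 6 → ℂ) (u : Fin 6 → ℝ) :
    majorant d (c • x) u = majorant d x u := by
  have h : bil (gramL d) (c • x) (fun i => (u i : ℂ)) = c * bil (gramL d) x fun i => (u i : ℂ) := by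
    have := bil_smul_smul (gramL d) c 1 x fun i => (u i : ℂ)
    simpa using this
  rw [majorant, majorant, h, bil_smul_star, Complex.normSq_mul]
  have := (Complex.normSq_pos.2 hc).ne'
  rw [mul_left_comm, mul_div_mul_left _ _ this]

theorem majorant_real_smul {d : ℕ} (r : ℝ) (x : Fin 6 → ℂ) (u : Fin 6 → ℝ) :
    majorant d x (r • u) = r ^ 2 * majorant d x u := by
  have h : bil (gramL d) x (fun i => ((r • u) i : ℂ)) =
      r * bil (gramL d) x fun i => (u i : ℂ) := by
    have := bil_smul_smul (gramL d) 1 (r : ℂ) x fun i => (u i : ℂ)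
    simp only [one_smul, one_mul] at this
    rw [← this]
    congr 1
    ext i
    simp
  rw [majorant, majorant, h, bil_smul_smul, Complex.normSq_mul, Complex.normSq_ofReal]
  ring

theorem majorant_actC {d : ℕ} {g : GL (Fin 6) ℤ} (hg : g ∈ orthogonal (gramL d) ℤ)
    (x : Fin 6 → ℂ) (u : Fin 6 → ℝ) :
    majorant d (actC g x) ((g : Matrix (Fin 6) (Fin 6) ℤ).map (Int.cast : ℤ → ℝ) *ᵥ u) =
      majorant d x u := by
  have h1 : (fun i => (((g : Matrix (Fin 6) (Fin 6) ℤ).map (Int.cast : ℤ → ℝ) *ᵥ u) i : ℂ)) =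
      actC g fun i => (u i : ℂ) := by
    ext i
    simp [actC, Matrix.mulVec, dotProduct]
  have h2 : bil (gramL d) ((g : Matrix (Fin 6) (Fin 6) ℤ).map (Int.cast : ℤ → ℝ) *ᵥ u)
      ((g : Matrix (Fin 6) (Fin 6) ℤ).map (Int.cast : ℤ → ℝ) *ᵥ u) = bil (gramL d) u u :=
    (map_mem_orthogonal_iff _ g ℝ).2 hg u u
  rw [majorant, majorant, h1, h2, star_actC, bil_actC hg, bil_actC hg]

/-- On this subspace the form is -2y₀² - 2y₂² - 2d y₄² - 6y₅². -/
theorem bil_neg_of_anisotropic_complement {d : ℕ} (hd : 0 < d) {y : Fin 6 → ℝ}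
    (h1 : y 0 + y 1 = 0) (h2 : y 2 + y 3 = 0) (hy : y ≠ 0) : bil (gramL d) y y < 0 := by
  have hd' : (0 : ℝ) < d := by exact_mod_cast hd
  have e1 : y 1 = -y 0 := by linarith
  have e3 : y 3 = -y 2 := by linarith
  rw [bil_gramL, e1, e3]
  by_contra hneg
  push Not at hneg
  have q0 := mul_self_nonneg (y 0)
  have q2 := mul_self_nonneg (y 2)
  have q4 := mul_nonneg hd'.le (mul_self_nonneg (y 4))
  have q5 := mul_self_nonneg (y 5)
  have y0 : y 0 = 0 := mul_self_eq_zero.1 (by linarith)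
  have y2 : y 2 = 0 := mul_self_eq_zero.1 (by linarith)
  have y5 : y 5 = 0 := mul_self_eq_zero.1 (by linarith)
  have y4 : y 4 = 0 := mul_self_eq_zero.1
    ((mul_eq_zero.1 (by linarith : (d : ℝ) * (y 4 * y 4) = 0)).resolve_left hd'.ne')
  refine hy (funext fun i => ?_)
  fin_cases i <;> simp [y0, y2, y4, y5, e1, e3]

theorem bil_lin_comb {d : ℕ} (s t : ℝ) (a b : Fin 6 → ℝ) :
    bil (gramL d) (s • a + t • b) (s • a + t • b) = s ^ 2 * bil (gramL d) a a +
      2 * s * t * bil (gramL d) a b + t ^ 2 * bil (gramL d) b b := by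
  simp only [bil_gramL, Pi.add_apply, Pi.smul_apply, smul_eq_mul]
  ring

/-- The orthogonal complement of a positive plane is negative definite. -/
theorem bil_neg_of_orthogonal {d : ℕ} (hd : 0 < d) {a b w : Fin 6 → ℝ} {m : ℝ} (hm : 0 < m)
    (haa : bil (gramL d) a a = m) (hbb : bil (gramL d) b b = m) (hab : bil (gramL d) a b = 0)
    (hwa : bil (gramL d) w a = 0) (hwb : bil (gramL d) w b = 0) (hw : w ≠ 0) :
    bil (gramL d) w w < 0 := by
  have hcomb : ∀ s t : ℝ, (s • a + t • b) 0 + (s • a + t • b) 1 = 0 →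
      (s • a + t • b) 2 + (s • a + t • b) 3 = 0 → s = 0 ∧ t = 0 := by
    intro s t h1 h2
    have hb := bil_lin_comb (d := d) s t a b
    rw [haa, hbb, hab] at hb
    have hle : bil (gramL d) (s • a + t • b) (s • a + t • b) ≤ 0 := by
      by_cases h0 : s • a + t • b = 0
      · rw [h0]; simp [bil]
      · exact (bil_neg_of_anisotropic_complement hd h1 h2 h0).le
    have hs := mul_nonneg (sq_nonneg s) hm.le
    have ht := mul_nonneg (sq_nonneg t) hm.le
    have hs' : s ^ 2 * m = 0 := by linarith
    have ht' : t ^ 2 * m = 0 := by linarith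
    exact ⟨by simpa [hm.ne'] using hs', by simpa [hm.ne'] using ht'⟩
  set a1 := a 0 + a 1 with ha1
  set a2 := a 2 + a 3 with ha2
  set b1 := b 0 + b 1 with hb1
  set b2 := b 2 + b 3 with hb2
  -- The projection y ↦ (y₀ + y₁, y₂ + y₃) has negative definite kernel, so it is injective on the
  -- positive plane spanned by a and b, hence an isomorphism onto ℝ².
  have hdet : a1 * b2 - a2 * b1 ≠ 0 := by
    intro h0
    obtain ⟨hb10, ha10⟩ := hcomb b1 (-a1) (by simp; ring_nf; simp [ha1, hb1]; ring) (by
      simp; linear_combination -h0)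
    obtain ⟨hb20, ha20⟩ := hcomb b2 (-a2) (by simp; linear_combination h0) (by
      simp; ring_nf; simp [ha2, hb2]; ring)
    have := hcomb 1 0 (by simp; linarith) (by simp; linarith)
    exact one_ne_zero this.1
  -- Cramer's rule: s a + t b has the same projection as w, so the difference lies in the negative
  -- definite kernel, while its norm is (w, w) + (s² + t²) m.
  set s := ((w 0 + w 1) * b2 - (w 2 + w 3) * b1) / (a1 * b2 - a2 * b1) with hs
  set t := (a1 * (w 2 + w 3) - a2 * (w 0 + w 1)) / (a1 * b2 - a2 * b1) with ht
  have e1 : s * a1 + t * b1 = w 0 + w 1 := by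
    rw [hs, ht, div_mul_eq_mul_div, div_mul_eq_mul_div, ← add_div, div_eq_iff hdet]; ring
  have e2 : s * a2 + t * b2 = w 2 + w 3 := by
    rw [hs, ht, div_mul_eq_mul_div, div_mul_eq_mul_div, ← add_div, div_eq_iff hdet]; ring
  have hy : bil (gramL d) (w - (s • a + t • b)) (w - (s • a + t • b)) =
      bil (gramL d) w w + s ^ 2 * m + t ^ 2 * m := by
    have : bil (gramL d) (w - (s • a + t • b)) (w - (s • a + t • b)) =
        bil (gramL d) w w - 2 * s * bil (gramL d) w a - 2 * t * bil (gramL d) w b +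
        bil (gramL d) (s • a + t • b) (s • a + t • b) := by
      simp only [bil_gramL, Pi.add_apply, Pi.sub_apply, Pi.smul_apply, smul_eq_mul]
      ring
    rw [this, bil_lin_comb, haa, hbb, hab, hwa, hwb]
    ring
  have hs0 := mul_nonneg (sq_nonneg s) hm.le
  have ht0 := mul_nonneg (sq_nonneg t) hm.le
  by_cases h0 : w - (s • a + t • b) = 0
  · rw [h0] at hy
    have hz : bil (gramL d) (0 : Fin 6 → ℝ) 0 = 0 := by simp [bil]
    rw [hz] at hy
    have hst : ¬ (s = 0 ∧ t = 0) := by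
      rintro ⟨h1, h2⟩
      rw [h1, h2] at h0
      exact hw (by simpa using h0)
    have : 0 < s ^ 2 * m + t ^ 2 * m := by
      rw [not_and_or] at hst
      rcases hst with h | h <;> positivity
    linarith
  · have := bil_neg_of_anisotropic_complement hd (y := w - (s • a + t • b))
      (by simp; linarith) (by simp; linarith) h0
    linarith

/-- Real and imaginary parts of x span a positive plane, being orthogonal of equal norm m. With w
the component of u orthogonal to this plane, the majorant keeps the form on the plane and changes
its sign on w, where it is negative. -/
theorem majorant_pos {d : ℕ} (hd : 0 < d) {x : Fin 6 → ℂ} (h1 : bil (gramL d) x x = 0)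
    (h2 : 0 < (bil (gramL d) x (star x)).re) {u : Fin 6 → ℝ} (hu : u ≠ 0) :
    0 < majorant d x u := by
  set a : Fin 6 → ℝ := fun i => (x i).re with ha
  set b : Fin 6 → ℝ := fun i => (x i).im with hb
  have hre : bil (gramL d) a a - bil (gramL d) b b = 0 := by
    have := congrArg Complex.re h1
    rw [bil_gramL] at this
    simp at this
    rw [bil_gramL, bil_gramL]
    linarith
  have him : bil (gramL d) a b = 0 := by
    have := congrArg Complex.im h1
    rw [bil_gramL] at this
    simp at this
    rw [bil_gramL]
    linarith
  have hst : (bil (gramL d) x (star x)).re = bil (gramL d) a a + bil (gramL d) b b := by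
    simp only [bil_gramL]
    simp [ha, hb]
    ring
  have hns : Complex.normSq (bil (gramL d) x fun i => (u i : ℂ)) =
      bil (gramL d) u a ^ 2 + bil (gramL d) u b ^ 2 := by
    rw [Complex.normSq_apply]
    simp only [bil_gramL]
    simp [ha, hb]
    ring
  set m := bil (gramL d) a a with hm
  have hbb : bil (gramL d) b b = m := by linarith
  have hmpos : 0 < m := by linarith
  rw [majorant, hns, hst, hbb]
  set α := bil (gramL d) u a / m with hα
  set β := bil (gramL d) u b / m with hβ
  have ea : bil (gramL d) u a = α * m := by rw [hα]; field_simp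
  have eb : bil (gramL d) u b = β * m := by rw [hβ]; field_simp
  set w := u - (α • a + β • b) with hw
  have lin : ∀ c : Fin 6 → ℝ, bil (gramL d) w c =
      bil (gramL d) u c - α * bil (gramL d) a c - β * bil (gramL d) b c := fun c => by
    simp only [hw, bil_gramL, Pi.add_apply, Pi.sub_apply, Pi.smul_apply, smul_eq_mul]
    ring
  have symm : ∀ c e : Fin 6 → ℝ, bil (gramL d) c e = bil (gramL d) e c := fun c e => by
    simp only [bil_gramL]; ring
  have hwa : bil (gramL d) w a = 0 := by
    rw [lin, symm b a, him, ← hm, ea]; ring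
  have hwb : bil (gramL d) w b = 0 := by
    rw [lin, him, hbb, eb]; ring
  have huu : bil (gramL d) u u = bil (gramL d) w w + m * (α ^ 2 + β ^ 2) := by
    have e1 := lin u
    have e2 := lin w
    rw [symm u w, symm a w, symm b w, hwa, hwb] at e2
    rw [symm a u, symm b u, ea, eb] at e1
    linear_combination -e1 - e2
  have hexp : 4 * ((α * m) ^ 2 + (β * m) ^ 2) / (m + m) = 2 * m * (α ^ 2 + β ^ 2) := by
    field_simp; ring
  rw [ea, eb, hexp, huu]
  have hn : 0 ≤ m * (α ^ 2 + β ^ 2) := by positivity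
  by_cases hw0 : w = 0
  · have : bil (gramL d) w w = 0 := by rw [hw0]; simp [bil]
    rw [this]
    have hne : ¬ (α = 0 ∧ β = 0) := by
      rintro ⟨e1, e2⟩
      rw [e1, e2] at hw
      exact hu (by simpa [hw0] using hw.symm)
    have : 0 < m * (α ^ 2 + β ^ 2) := by
      rw [not_and_or] at hne
      rcases hne with h | h <;> positivity
    linarith
  · have := bil_neg_of_orthogonal hd hmpos rfl hbb him hwa hwb hw0
    linarith

theorem continuous_majorant (d : ℕ) :
    Continuous fun p : periodDomain d × (Fin 6 → ℝ) => majorant d (normalize0 p.1) p.2 := by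
  have h1 : Continuous fun p : periodDomain d × (Fin 6 → ℝ) => (normalize0 p.1 : Fin 6 → ℂ) :=
    (continuous_normalize0 d).comp continuous_fst
  have h1' : ∀ i, Continuous fun p : periodDomain d × (Fin 6 → ℝ) => (normalize0 p.1 : Fin 6 → ℂ) i :=
    fun i => (continuous_apply i).comp h1
  have h2 : ∀ i, Continuous fun p : periodDomain d × (Fin 6 → ℝ) => p.2 i := fun i => by fun_prop
  unfold majorant
  refine Continuous.sub (Continuous.div₀ ?_ ?_ ?_) ?_
  · simp only [bil_gramL]
    fun_prop
  · simp only [bil_gramL, Pi.star_apply]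
    fun_prop
  · intro p
    exact (normalize0_mem p.1).2.1.ne'
  · simp only [bil_gramL]
    fun_prop

theorem finite_bounded_matrices (B : Fin 6 → ℝ) :
    {g : GL (Fin 6) ℤ | ∀ i j, ((g : Matrix (Fin 6) (Fin 6) ℤ) i j : ℝ) ^ 2 ≤ B j}.Finite := by
  have h : (Set.pi Set.univ fun _ : Fin 6 => Set.pi Set.univ fun j : Fin 6 =>
      Set.Icc (-⌈B j⌉) ⌈B j⌉).Finite :=
    Set.Finite.pi fun _ => Set.Finite.pi fun j => Set.finite_Icc _ _
  refine Set.Finite.of_finite_image (f := fun g : GL (Fin 6) ℤ => (g : Matrix (Fin 6) (Fin 6) ℤ))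
    (h.subset ?_) (fun _ _ _ _ h => Units.ext h)
  rintro _ ⟨g, hg, rfl⟩ i - j -
  have h1 : (((g : Matrix (Fin 6) (Fin 6) ℤ) i j ^ 2 : ℤ) : ℝ) ≤ B j := by
    push_cast; exact hg i j
  have h2 : (g : Matrix (Fin 6) (Fin 6) ℤ) i j ^ 2 ≤ ⌈B j⌉ := by
    exact_mod_cast h1.trans (Int.le_ceil _)
  have h3 := Int.le_self_sq ((g : Matrix (Fin 6) (Fin 6) ℤ) i j)
  have h4 := Int.le_self_sq (-(g : Matrix (Fin 6) (Fin 6) ℤ) i j)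
  rw [neg_sq] at h4
  exact Set.mem_Icc.2 ⟨by linarith, by linarith⟩

/-- If v and g v are both near q₀, the majorant at g v bounds c‖g e_j‖² from above, while invariance
equates its value on g e_j with that of e_j at v, which is bounded. So the columns of g are bounded.
-/
theorem isLocallyFiniteAction_domainGroup {d : ℕ} (hd : 0 < d) :
    IsLocallyFiniteAction (domainGroup d) (periodDomain d) := by
  intro q₀
  set Φ : periodDomain d × (Fin 6 → ℝ) → ℝ := fun p => majorant d (normalize0 p.1) p.2 with hΦ
  have hcont : Continuous Φ := continuous_majorant d
  have hS : IsCompact (Metric.sphere (0 : Fin 6 → ℝ) 1) := isCompact_sphere _ _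
  obtain ⟨c, hc, hcS⟩ : ∃ c > 0, ∀ u ∈ Metric.sphere (0 : Fin 6 → ℝ) 1, c < Φ (q₀, u) := by
    have hpos : ∀ u ∈ Metric.sphere (0 : Fin 6 → ℝ) 1, 0 < Φ (q₀, u) := fun u hu =>
      majorant_pos hd (normalize0_mem q₀).1 (normalize0_mem q₀).2.1
        (ne_zero_of_mem_unit_sphere ⟨u, hu⟩)
    have hne : (Metric.sphere (0 : Fin 6 → ℝ) 1).Nonempty :=
      NormedSpace.sphere_nonempty.2 zero_le_one
    obtain ⟨u₀, hu₀, hmin⟩ := hS.exists_isMinOn hne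
      (hcont.comp (Continuous.prodMk_right q₀)).continuousOn
    refine ⟨Φ (q₀, u₀) / 2, half_pos (hpos u₀ hu₀), fun u hu => ?_⟩
    exact (half_lt_self (hpos u₀ hu₀)).trans_le (hmin hu)
  -- The lower bound on the unit sphere at q₀ persists, by compactness of the sphere, for all points
  -- near q₀.
  obtain ⟨V₁, W, hV₁, -, hqV₁, hSW, hVW⟩ := generalized_tube_lemma (isCompact_singleton (x := q₀)) hS
    (isOpen_lt continuous_const hcont : IsOpen {p | c < Φ p}) (by
      rintro ⟨q, u⟩ ⟨hq, hu⟩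
      obtain rfl : q = q₀ := hq
      exact hcS u hu)
  let e : Fin 6 → Fin 6 → ℝ := fun j => Pi.single j 1
  let V₂ : Set (periodDomain d) := ⋂ j, {q | Φ (q, e j) < Φ (q₀, e j) + 1}
  have hV₂ : IsOpen V₂ := isOpen_iInter_of_finite fun j =>
    isOpen_lt (hcont.comp (Continuous.prodMk_left (e j))) continuous_const
  refine ⟨V₁ ∩ V₂, hV₁.inter hV₂, ⟨hqV₁ rfl, Set.mem_iInter.2 fun j =>
    (lt_add_one _ : Φ (q₀, e j) < Φ (q₀, e j) + 1)⟩, ?_⟩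
  refine Set.Finite.of_finite_image (f := fun g : domainGroup d => (g : GL (Fin 6) ℤ))
    ((finite_bounded_matrices fun j => (Φ (q₀, e j) + 1) / c).subset ?_)
    (fun _ _ _ _ h => Subtype.ext h)
  rintro _ ⟨g, ⟨v, hv, hgv⟩, rfl⟩ i j
  set u : Fin 6 → ℝ :=
    ((g : GL (Fin 6) ℤ) : Matrix (Fin 6) (Fin 6) ℤ).map (Int.cast : ℤ → ℝ) *ᵥ e j with hu
  have hui : u i = (((g : GL (Fin 6) ℤ) : Matrix (Fin 6) (Fin 6) ℤ) i j : ℝ) := by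
    simp [hu, e]
  have hinv : Φ (g • v, u) = Φ (v, e j) := by
    obtain ⟨c, hc, h⟩ := exists_smul_normalize0 g v
    simp only [hΦ]
    rw [h, majorant_smul c hc, hu, majorant_actC g.2.1.1.1]
  have hupper : Φ (g • v, u) < Φ (q₀, e j) + 1 := hinv ▸ Set.mem_iInter.1 hv.2 j
  have hlower : c * ‖u‖ ^ 2 ≤ Φ (g • v, u) := by
    by_cases hu0 : u = 0
    · have : Φ (g • v, u) = 0 := by
        have := majorant_real_smul (d := d) 0 (normalize0 (g • v : periodDomain d)) 0
        simp only [hΦ, hu0]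
        simpa using this
      rw [this, hu0]; simp
    · have hn : 0 < ‖u‖ := norm_pos_iff.2 hu0
      have hmem : ‖u‖⁻¹ • u ∈ Metric.sphere (0 : Fin 6 → ℝ) 1 := by
        simp [norm_smul, hn.ne']
      have h1 : c < Φ (g • v, ‖u‖⁻¹ • u) := hVW (Set.mk_mem_prod hgv.1 (hSW hmem))
      have h2 : Φ (g • v, ‖u‖⁻¹ • u) = ‖u‖⁻¹ ^ 2 * Φ (g • v, u) := majorant_real_smul _ _ _
      rw [h2, inv_pow, inv_mul_eq_div, lt_div_iff₀ (by positivity)] at h1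
      exact h1.le
  rw [le_div_iff₀ hc, ← hui]
  have h3 : (u i) ^ 2 ≤ ‖u‖ ^ 2 := by
    rw [← sq_abs]
    exact pow_le_pow_left₀ (abs_nonneg _) (norm_le_pi_norm u i) 2
  calc (u i) ^ 2 * c ≤ ‖u‖ ^ 2 * c := mul_le_mul_of_nonneg_right h3 hc.le
    _ ≤ _ := by rw [mul_comm]; exact hlower.trans hupper.le

/-! ### Fixed points -/

/-- The minor of rows `0, b` of the matrix with columns `x` and `g x`. -/
noncomputable def fixMinor (g : GL (Fin 6) ℤ) (b : Fin 6) (x : Fin 6 → ℂ) : ℂ :=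
  x 0 * actC g x b - x b * actC g x 0

/-- Since x₀ ≠ 0 on the period domain, the minors with row 0 alone express proportionality of x and
g x. -/
theorem smul_eq_iff_fixMinor {d : ℕ} (g : domainGroup d) {x : Fin 6 → ℂ} (hx : x ≠ 0)
    (hD : Projectivization.mk ℂ x hx ∈ periodDomain d) :
    g • (⟨_, hD⟩ : periodDomain d) = ⟨_, hD⟩ ↔ ∀ b, fixMinor g b x = 0 := by
  rw [Subtype.ext_iff, coe_smul_periodDomain, toGLC_smul_mk, Projectivization.mk_eq_mk_iff']
  constructor
  · rintro ⟨c, hc⟩ b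
    rw [fixMinor, ← hc]
    simp only [Pi.smul_apply, smul_eq_mul]
    ring
  · intro h
    have hpos := (mk_mem_periodDomain_iff hx).1 hD
    have h0 := zero_ne_of_mem_Omega hpos.1 hpos.2.1
    refine ⟨(x 0)⁻¹ * actC g x 0, ?_⟩
    ext b
    have := h b
    rw [fixMinor] at this
    simp only [Pi.smul_apply, smul_eq_mul]
    field_simp
    linear_combination -this

theorem differentiable_actC (g : GL (Fin 6) ℤ) : Differentiable ℂ (actC g) :=
  (Matrix.mulVecLin ((g : Matrix (Fin 6) (Fin 6) ℤ).map (Int.cast : ℤ → ℂ))).toContinuousLinearMap.differentiable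

/-- In the tube chart the fixed points are common zeros of holomorphic functions. If these vanish
near one point, they vanish on the whole connected tube, and g acts trivially. -/
theorem interior_fixed_eq_empty {d : ℕ} (g : domainGroup d) (hg : ∃ y : periodDomain d, g • y ≠ y) :
    interior {q : periodDomain d | g • q = q} = ∅ := by
  by_contra hne
  obtain ⟨q₀, hq₀⟩ := Set.nonempty_iff_ne_empty.2 hne
  obtain ⟨y, hy⟩ := hg
  obtain ⟨O, hO, hOq⟩ := isOpen_induced_iff.1 (isOpen_interior (s := {q : periodDomain d | g • q = q}))
  obtain ⟨z₀, hz₀, -, hq₀z⟩ := exists_tubeLift q₀.2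
  obtain ⟨z₁, hz₁, -, hyz⟩ := exists_tubeLift y.2
  have hmem : ∀ z ∈ tube d, Projectivization.mk ℂ (tubeLift d z) (tubeLift_ne_zero d z) ∈
      periodDomain d := fun z hz =>
    (mk_mem_periodDomain_iff _).2 (tubeLift_mem_positiveCone hz)
  have hq₀O : Projectivization.mk ℂ (tubeLift d z₀) (tubeLift_ne_zero d z₀) ∈ O := by
    rw [← hq₀z]
    exact hOq.superset hq₀
  have hnear : ∀ᶠ z in 𝓝 z₀, ∀ b, fixMinor g b (tubeLift d z) = 0 := by
    have h1 := (continuous_projectivization_mk (continuous_tubeLift d)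
      (tubeLift_ne_zero d)).continuousAt.preimage_mem_nhds (hO.mem_nhds hq₀O)
    filter_upwards [h1, (isOpen_tube d).mem_nhds hz₀] with z hz hzt
    refine (smul_eq_iff_fixMinor g _ (hmem z hzt)).1 ?_
    have : (⟨_, hmem z hzt⟩ : periodDomain d) ∈ interior {q : periodDomain d | g • q = q} :=
      hOq.subset hz
    have hfix := interior_subset this
    exact hfix
  refine hy ?_
  have hy' : y = ⟨_, hmem z₁ hz₁⟩ := Subtype.ext hyz
  rw [hy', smul_eq_iff_fixMinor]
  intro b
  have hcoord : ∀ i, AnalyticOnNhd ℂ (fun z => tubeLift d z i) (tube d) := by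
    intro i z _
    have h : ∀ j, AnalyticAt ℂ (fun z : Fin 4 → ℂ => z j) z := fun j =>
      (ContinuousLinearMap.proj (R := ℂ) (φ := fun _ : Fin 4 => ℂ) j).analyticAt z
    fin_cases i
    · exact analyticAt_const
    · exact ((((h 0).mul (h 1)).sub (analyticAt_const.mul ((h 2).pow 2))).sub
        (analyticAt_const.mul ((h 3).pow 2))).neg
    · exact h 0
    · exact h 1
    · exact h 2
    · exact h 3
  have hact : ∀ i, AnalyticOnNhd ℂ (fun z => actC g (tubeLift d z) i) (tube d) := by
    intro i z hz
    have : (fun z => actC g (tubeLift d z) i) =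
        fun z => ∑ j, (((g : GL (Fin 6) ℤ) : Matrix (Fin 6) (Fin 6) ℤ) i j : ℂ) * tubeLift d z j := by
      ext z; simp [actC, Matrix.mulVec, dotProduct]
    rw [this]
    exact Finset.analyticAt_fun_sum _ fun j _ => analyticAt_const.mul (hcoord j z hz)
  have han : AnalyticOnNhd ℂ (fun z => fixMinor g b (tubeLift d z)) (tube d) := fun z hz =>
    ((hcoord 0 z hz).mul (hact b z hz)).sub ((hcoord b z hz).mul (hact 0 z hz))
  exact han.eqOn_of_preconnected_of_eventuallyEq (g := fun _ => 0) (fun z _ => analyticAt_const)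
    (convex_tube d).isPreconnected hz₀ (hnear.mono fun z hz => hz b) hz₁

end Action

/-! ### The branch locus is analytic -/

section Analytic

/-- The points of the cone over an open subset of the period domain form an open subset of the
cone. -/
theorem exists_isOpen_cone {d : ℕ} {O : Set (periodDomain d)} (hO : IsOpen O) :
    ∃ W : Set (Fin 6 → ℂ), IsOpen W ∧
      ∀ (y : Fin 6 → ℂ) (hy : y ≠ 0) (hD : Projectivization.mk ℂ y hy ∈ periodDomain d),
        y ∈ W ↔ (⟨_, hD⟩ : periodDomain d) ∈ O := by
  obtain ⟨O', hO', rfl⟩ := isOpen_induced_iff.1 hO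
  have hne : IsOpen {v : Fin 6 → ℂ | v ≠ 0} := isOpen_ne
  refine ⟨_, hne.isOpenMap_subtype_val _
    (hO'.preimage isOpenQuotientMap_projectivization_mk.continuous), fun y hy hD => ?_⟩
  constructor
  · rintro ⟨⟨v, hv⟩, hvO, rfl⟩
    exact hvO
  · intro h
    exact ⟨⟨y, hy⟩, h, rfl⟩

theorem smul_mk_eq {d : ℕ} (g : domainGroup d) {y : Fin 6 → ℂ} (hy : y ≠ 0)
    (hD : Projectivization.mk ℂ y hy ∈ periodDomain d) :
    ∃ hD' : Projectivization.mk ℂ _ (actC_ne_zero (g := (g : GL (Fin 6) ℤ)) hy) ∈ periodDomain d,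
      g • (⟨_, hD⟩ : periodDomain d) = ⟨_, hD'⟩ :=
  ⟨smul_mem_periodDomain g ⟨_, hD⟩, rfl⟩

theorem zero_ne_of_mem_periodDomain {d : ℕ} {y : Fin 6 → ℂ} {hy : y ≠ 0}
    (hD : Projectivization.mk ℂ y hy ∈ periodDomain d) : y 0 ≠ 0 := by
  have := (mk_mem_periodDomain_iff hy).1 hD
  exact zero_ne_of_mem_Omega this.1 this.2.1

theorem differentiable_fixMinor (g : GL (Fin 6) ℤ) (b : Fin 6) :
    Differentiable ℂ (fixMinor g b) := by
  have h : ∀ i, Differentiable ℂ fun x : Fin 6 → ℂ => x i := fun i =>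
    (ContinuousLinearMap.proj (R := ℂ) (φ := fun _ : Fin 6 => ℂ) i).differentiable
  have h' : ∀ i, Differentiable ℂ fun x : Fin 6 → ℂ => actC g x i := fun i =>
    (h i).comp (differentiable_actC g)
  exact ((h 0).mul (h' b)).sub ((h b).mul (h' 0))

/-- The minors of `(x, g x)` as the coefficients of a polynomial. -/
noncomputable def fixPoly (g : GL (Fin 6) ℤ) (x : Fin 6 → ℂ) : Polynomial ℂ :=
  ∑ b : Fin 6, Polynomial.C (fixMinor g b x) * Polynomial.X ^ (b : ℕ)

/-- Packing the six equations into one polynomial lets a union of fixed-point sets be described by a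
product, because ℂ[X] is a domain. -/
theorem fixPoly_eq_zero_iff (g : GL (Fin 6) ℤ) (x : Fin 6 → ℂ) :
    fixPoly g x = 0 ↔ ∀ b, fixMinor g b x = 0 := by
  constructor
  · intro h b
    have := congrArg (fun P => Polynomial.coeff P b) h
    simpa [fixPoly, Polynomial.coeff_C_mul, Polynomial.coeff_X_pow, Fin.val_inj] using this
  · intro h
    simp [fixPoly, h]

theorem natDegree_fixPoly_le (g : GL (Fin 6) ℤ) (x : Fin 6 → ℂ) : (fixPoly g x).natDegree ≤ 5 := by
  refine Polynomial.natDegree_sum_le_of_forall_le _ _ fun b _ => ?_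
  exact (Polynomial.natDegree_C_mul_X_pow_le _ _).trans (by omega)

theorem differentiable_eval_fixPoly (g : GL (Fin 6) ℤ) (c : ℂ) :
    Differentiable ℂ fun x => (fixPoly g x).eval c := by
  have : (fun x => (fixPoly g x).eval c) = fun x => ∑ b : Fin 6, fixMinor g b x * c ^ (b : ℕ) := by
    ext x
    simp [fixPoly, Polynomial.eval_finsetSum]
  rw [this]
  exact Differentiable.fun_sum fun b _ => (differentiable_fixMinor g b).mul_const _

variable {d : ℕ}

/-- The product over `g ∈ B` and `s ∈ S` of the polynomials which test whether `g` fixes `s q`. -/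
noncomputable def branchPoly (B S : Finset (domainGroup d)) (q : periodDomain d) : Polynomial ℂ :=
  ∏ g ∈ B, ∏ s ∈ S, fixPoly g (normalize0 (s • q : periodDomain d))

theorem natDegree_branchPoly_le (B S : Finset (domainGroup d)) (q : periodDomain d) :
    (branchPoly B S q).natDegree ≤ B.card * (S.card * 5) := by
  refine (Polynomial.natDegree_prod_le _ _).trans ?_
  refine Finset.sum_le_card_nsmul _ _ _ fun g _ => ?_
  refine (Polynomial.natDegree_prod_le _ _).trans ?_
  exact Finset.sum_le_card_nsmul _ _ _ fun s _ => natDegree_fixPoly_le _ _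

theorem fixPoly_normalize0_eq_zero_iff (g : domainGroup d) (q : periodDomain d) :
    fixPoly g (normalize0 q) = 0 ↔ g • q = q := by
  have hq : (⟨_, (mk_normalize0_eq q).symm ▸ q.2⟩ : periodDomain d) = q :=
    Subtype.ext (mk_normalize0_eq q)
  rw [fixPoly_eq_zero_iff, ← smul_eq_iff_fixMinor g (normalize0_ne_zero q)
    ((mk_normalize0_eq q).symm ▸ q.2), hq]

/-- The value at `c` of `branchPoly`, as a function on the quotient which is supported on the
image of a slice. -/
noncomputable def branchFun (B S : Finset (domainGroup d)) (V : Set (periodDomain d)) (c : ℂ)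
    (z : ModVar d) : ℂ :=
  open Classical in
  if h : ∃ v ∈ V, modProj d v = z then
    (branchPoly B S h.choose).eval c else 0

/-- Right multiplication by g permutes the stabilizer S of q₀. The product over S is there for this
invariance, which lets the function descend to the quotient. -/
theorem branchPoly_smul {q₀ : periodDomain d} (B S : Finset (domainGroup d))
    (hS : ∀ s, s ∈ S ↔ s • q₀ = q₀) {g : domainGroup d} (hg : g • q₀ = q₀) (v : periodDomain d) :
    branchPoly B S (g • v) = branchPoly B S v := by
  refine Finset.prod_congr rfl fun k _ => ?_
  refine Finset.prod_bij' (fun s _ => s * g) (fun s _ => s * g⁻¹) (fun s hs => ?_) (fun s hs => ?_)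
    (fun s _ => mul_inv_cancel_right s g) (fun s _ => inv_mul_cancel_right s g) fun s _ => ?_
  · rw [hS] at hs ⊢
    rw [mul_smul, hg, hs]
  · rw [hS] at hs ⊢
    rw [mul_smul, inv_smul_eq_iff.2 hg.symm, hs]
  · rw [mul_smul]

/-- The chosen preimage does not matter: two points of the slice over the same point differ by an
element of the stabilizer. -/
theorem branchFun_mk {q₀ : periodDomain d} {V : Set (periodDomain d)}
    (hV : IsSliceAt (domainGroup d) q₀ V) (B S : Finset (domainGroup d))
    (hS : ∀ s, s ∈ S ↔ s • q₀ = q₀) (c : ℂ) {v : periodDomain d} (hv : v ∈ V) :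
    branchFun B S V c (modProj d v) = (branchPoly B S v).eval c := by
  have h : ∃ w ∈ V, modProj d w = modProj d v := ⟨v, hv, rfl⟩
  rw [branchFun, dif_pos h]
  have hspec := h.choose_spec
  generalize h.choose = w at hspec
  obtain ⟨g, -, rfl⟩ := ((isQuotientBy_modProj d).eq_iff w v).1 hspec.2
  rw [branchPoly_smul B S hS (hV.smul_eq g w hspec.1 hv)]

theorem isHolomorphicOn_branchFun {q₀ : periodDomain d} {V : Set (periodDomain d)}
    (hV : IsSliceAt (domainGroup d) q₀ V) (B S : Finset (domainGroup d))
    (hS : ∀ s, s ∈ S ↔ s • q₀ = q₀) (c : ℂ) :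
    IsHolomorphicOn d (modProj d '' V) (branchFun B S V c) := by
  classical
  rintro x hx hD ⟨v, hv, hvx⟩
  -- The point x need not lie over V itself, so k moves it there; the local extension is written in
  -- terms of k y, rescaled to have first coordinate 1.
  obtain ⟨k, -, hk⟩ := ((isQuotientBy_modProj d).eq_iff _ _).1 hvx.symm
  obtain ⟨W, hW, hWO⟩ := exists_isOpen_cone (hV.isOpen.preimage (continuous_const_smul k))
  let N : domainGroup d → (Fin 6 → ℂ) → Fin 6 → ℂ := fun s y =>
    (actC ((s * k : domainGroup d) : GL (Fin 6) ℤ) y 0)⁻¹ • actC ((s * k : domainGroup d) : GL (Fin 6) ℤ) y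
  let D : Set (Fin 6 → ℂ) := ⋂ s ∈ S, {y | actC ((s * k : domainGroup d) : GL (Fin 6) ℤ) y 0 ≠ 0}
  have hDopen : IsOpen D := S.finite_toSet.isOpen_biInter fun s _ =>
    isOpen_ne.preimage ((continuous_apply 0).comp (continuous_actC _))
  have hDmem : ∀ (y : Fin 6 → ℂ) (hy : y ≠ 0)
      (_ : Projectivization.mk ℂ y hy ∈ periodDomain d), y ∈ D := by
    intro y hy hyD
    refine Set.mem_iInter₂.2 fun s _ => ?_
    obtain ⟨hD', -⟩ := smul_mk_eq (s * k) hy hyD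
    exact zero_ne_of_mem_periodDomain hD'
  have hN : ∀ s (y : Fin 6 → ℂ) (hy : y ≠ 0) (hyD : Projectivization.mk ℂ y hy ∈ periodDomain d),
      (normalize0 (s • k • (⟨_, hyD⟩ : periodDomain d) : periodDomain d)) = N s y := by
    intro s y hy hyD
    obtain ⟨hD', h⟩ := smul_mk_eq (s * k) hy hyD
    rw [← mul_smul, h, normalize0_mk]
  have hNdiff : ∀ s ∈ S, DifferentiableOn ℂ (N s) D := by
    intro s hs
    have h0 : Differentiable ℂ fun y => actC ((s * k : domainGroup d) : GL (Fin 6) ℤ) y 0 :=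
      (ContinuousLinearMap.proj (R := ℂ) (φ := fun _ : Fin 6 => ℂ) 0).differentiable.comp
        (differentiable_actC _)
    exact (h0.differentiableOn.inv fun y hy => Set.mem_iInter₂.1 hy s hs).smul
      (differentiable_actC _).differentiableOn
  refine ⟨W ∩ D, fun y => ∏ g ∈ B, ∏ s ∈ S, (fixPoly g (N s y)).eval c, hW.inter hDopen,
    ⟨(hWO x hx hD).2 (by rw [Set.mem_preimage, hk]; exact hv), hDmem x hx hD⟩, ?_, ?_⟩
  · have hprod : ∀ {ι : Type} (T : Finset ι) (F : ι → (Fin 6 → ℂ) → ℂ),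
        (∀ i ∈ T, DifferentiableOn ℂ (F i) (W ∩ D)) →
        DifferentiableOn ℂ (fun y => ∏ i ∈ T, F i y) (W ∩ D) := fun T F hF y hy =>
      (HasFDerivWithinAt.finsetProd fun i hi =>
        (hF i hi y hy).hasFDerivWithinAt).differentiableWithinAt
    refine hprod B _ fun g _ => hprod S _ fun s hs => ?_
    exact (differentiable_eval_fixPoly g c).comp_differentiableOn
      ((hNdiff s hs).mono Set.inter_subset_right)
  · intro y hy hyD hyW hyU
    have hkV : k • (⟨_, hyD⟩ : periodDomain d) ∈ V := (hWO y hy hyD).1 hyW.1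
    have hpt : ModVar.pt d y hy hyD = modProj d (k • (⟨_, hyD⟩ : periodDomain d)) :=
      ((isQuotientBy_modProj d).eq_iff _ _).2 ⟨k, trivial, rfl⟩
    rw [hpt, branchFun_mk hV B S hS c hkV, branchPoly, Polynomial.eval_prod]
    refine Finset.prod_congr rfl fun g _ => ?_
    rw [Polynomial.eval_prod]
    refine Finset.prod_congr rfl fun s _ => ?_
    rw [hN]

/-- On a slice the ramification is the vanishing locus of `branchPoly`. A polynomial of bounded
degree vanishes once it does at enough integers, so finitely many values `branchFun` at 0, 1, 2, …
suffice as equations. -/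
theorem isAnalyticSubset_ramification (hd : 0 < d) :
    IsAnalyticSubset (IsHolomorphicOn d)
      (modProj d '' ramification (domainGroup d) (periodDomain d)) := by
  classical
  intro y
  obtain ⟨q₀, rfl⟩ := (isQuotientBy_modProj d).isQuotientMap.surjective y
  obtain ⟨V, -, hV⟩ := (isLocallyFiniteAction_domainGroup hd).exists_isSliceAt q₀ isOpen_univ trivial
  set S := hV.finite.toFinset with hSdef
  have hS : ∀ s, s ∈ S ↔ s • q₀ = q₀ := fun s => by simp [hSdef]
  set B := S.filter fun g => ∃ y : periodDomain d, g • y ≠ y with hBdef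
  have hπ := isQuotientBy_modProj d
  refine ⟨_, hπ.isOpenMap V hV.isOpen, Set.mem_image_of_mem _ hV.mem,
    (fun c : ℕ => branchFun B S V c) '' Finset.range (B.card * (S.card * 5) + 1),
    (Finset.finite_toSet _).image _, ?_, ?_⟩
  · rintro _ ⟨c, -, rfl⟩
    exact isHolomorphicOn_branchFun hV B S hS c
  · ext z
    rw [Set.mem_inter_iff, and_comm]
    refine and_congr_right ?_
    rintro ⟨v, hv, rfl⟩
    have hram : modProj d v ∈
        modProj d '' ramification (domainGroup d) (periodDomain d) ↔ ∃ g ∈ B, g • v = v := by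
      rw [← Set.mem_preimage, preimage_image_ramification hπ]
      have := Set.ext_iff.1 hV.inter_ramification v
      rw [Set.mem_inter_iff, Set.mem_inter_iff, and_congr_right_iff] at this
      rw [this hv]
      simp [hBdef, hS]
    rw [hram, Set.forall_mem_image]
    have hval : ∀ c : ℕ, branchFun B S V c (modProj d v) =
        (branchPoly B S v).eval (c : ℂ) := fun c => branchFun_mk hV B S hS c hv
    simp only [hval]
    constructor
    · rintro ⟨g, hg, hgv⟩ c -
      have : branchPoly B S v = 0 := by
        refine Finset.prod_eq_zero hg (Finset.prod_eq_zero (i := 1) ((hS 1).2 (one_smul _ _)) ?_)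
        rw [one_smul, fixPoly_normalize0_eq_zero_iff]
        exact hgv
      rw [this, Polynomial.eval_zero]
    · intro h
      have hzero : branchPoly B S v = 0 := by
        refine Polynomial.eq_zero_of_natDegree_lt_card_of_eval_eq_zero _
          (ι := Fin (B.card * (S.card * 5) + 1)) (f := fun i => ((i : ℕ) : ℂ))
          (fun i j hij => Fin.ext (Nat.cast_injective hij)) (fun i =>
            h (Finset.mem_coe.2 (Finset.mem_range.2 i.2))) ?_
        rw [Fintype.card_fin]
        exact Nat.lt_succ_of_le (natDegree_branchPoly_le B S v)
      obtain ⟨g, hg, hg0⟩ := Finset.prod_eq_zero_iff.1 hzero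
      obtain ⟨s, hs, hs0⟩ := Finset.prod_eq_zero_iff.1 hg0
      rw [fixPoly_normalize0_eq_zero_iff] at hs0
      have hs' := (hS s).1 hs
      obtain ⟨hgS, y, hy⟩ := Finset.mem_filter.1 hg
      have hg' := (hS g).1 hgS
      -- A vanishing factor says that g fixes s v; then s⁻¹ g s fixes v, and it again stabilizes q₀
      -- and acts nontrivially.
      refine ⟨s⁻¹ * g * s, Finset.mem_filter.2 ⟨(hS _).2 ?_, s⁻¹ • y, ?_⟩, ?_⟩
      · rw [mul_smul, mul_smul, hs', hg', inv_smul_eq_iff, hs']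
      · simpa [mul_smul] using hy
      · rw [mul_smul, mul_smul, hs0, inv_smul_smul]

end Analytic

/-! ### The map of modular varieties -/

section Covering

variable {p : ℕ}

/-- The embedding of lattices extended to `ℂ⁶`. -/
noncomputable def embC (p : ℕ) (x : Fin 6 → ℂ) : Fin 6 → ℂ :=
  (embMat p).map (Int.cast : ℤ → ℂ) *ᵥ x

/-- The inverse of `embC`. -/
noncomputable def embInvC (p : ℕ) (x : Fin 6 → ℂ) : Fin 6 → ℂ :=
  (diagonal fun i => (embDiag p i : ℂ)⁻¹) *ᵥ x

theorem embC_apply (x : Fin 6 → ℂ) (i : Fin 6) : embC p x i = embDiag p i * x i :=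
  embMat_mulVec_apply p x i

theorem embInvC_embC (hp : p ≠ 0) (x : Fin 6 → ℂ) : embInvC p (embC p x) = x := by
  ext i
  have : (embDiag p i : ℂ) ≠ 0 := Int.cast_ne_zero.2 (embDiag_ne_zero hp i)
  rw [embInvC, Matrix.mulVec_diagonal, embC_apply]
  field_simp

theorem embC_embInvC (hp : p ≠ 0) (x : Fin 6 → ℂ) : embC p (embInvC p x) = x := by
  ext i
  have : (embDiag p i : ℂ) ≠ 0 := Int.cast_ne_zero.2 (embDiag_ne_zero hp i)
  rw [embC_apply, embInvC, Matrix.mulVec_diagonal]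
  field_simp

theorem differentiable_mulVec (A : Matrix (Fin 6) (Fin 6) ℂ) :
    Differentiable ℂ fun x : Fin 6 → ℂ => A *ᵥ x :=
  (Matrix.mulVecLin A).toContinuousLinearMap.differentiable

theorem embC_ne_zero (hp : p ≠ 0) {x : Fin 6 → ℂ} (hx : x ≠ 0) : embC p x ≠ 0 := fun h => by
  have := embInvC_embC hp x
  rw [h] at this
  exact hx (this.symm.trans (Matrix.mulVec_zero _))

theorem embInvC_ne_zero (hp : p ≠ 0) {x : Fin 6 → ℂ} (hx : x ≠ 0) : embInvC p x ≠ 0 := fun h => by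
  have := embC_embInvC hp x
  rw [h] at this
  exact hx (this.symm.trans (Matrix.mulVec_zero _))

/-- The embedding of lattices as an element of `GL₆(ℂ)`. -/
noncomputable def embGL (hp : p ≠ 0) : GL (Fin 6) ℂ where
  val := (embMat p).map (Int.cast : ℤ → ℂ)
  inv := diagonal fun i => (embDiag p i : ℂ)⁻¹
  val_inv := Matrix.toLin'.injective (LinearMap.ext fun x => by
    rw [Matrix.toLin'_apply, ← Matrix.mulVec_mulVec, Matrix.toLin'_apply, Matrix.one_mulVec]
    exact embC_embInvC hp x)
  inv_val := Matrix.toLin'.injective (LinearMap.ext fun x => by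
    rw [Matrix.toLin'_apply, ← Matrix.mulVec_mulVec, Matrix.toLin'_apply, Matrix.one_mulVec]
    exact embInvC_embC hp x)

theorem embGL_smul_mk (hp : p ≠ 0) {x : Fin 6 → ℂ} (hx : x ≠ 0) :
    embGL hp • Projectivization.mk ℂ x hx = Projectivization.mk ℂ (embC p x) (embC_ne_zero hp hx) :=
  rfl

/-- The embedding is an isometry and leaves the coordinates 0 and 2 unchanged, so it also respects
the sign that selects the component. -/
theorem embC_mem_positiveCone_iff (x : Fin 6 → ℂ) :
    embC p x ∈ positiveCone 1 ↔ x ∈ positiveCone (p ^ 2) := by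
  have hstar : star (embC p x) = embC p (star x) := by
    ext i
    simp [embC_apply]
  have h0 : embC p x 0 = x 0 := by rw [embC_apply, embDiag_of_ne (by decide)]; simp
  have h2 : embC p x 2 = x 2 := by rw [embC_apply, embDiag_of_ne (by decide)]; simp
  simp only [positiveCone, Set.mem_ofPred_eq, hstar, h0, h2]
  rw [embC, embC, bil_embMat, bil_embMat]

theorem embGL_smul_mem_iff (hp : p ≠ 0) (q : ℙ ℂ (Fin 6 → ℂ)) :
    embGL hp • q ∈ periodDomain 1 ↔ q ∈ periodDomain (p ^ 2) := by
  induction q using Projectivization.ind with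
  | h x hx =>
    rw [embGL_smul_mk, mk_mem_periodDomain_iff, mk_mem_periodDomain_iff, embC_mem_positiveCone_iff]

theorem embGL_inv_smul_mem (hp : p ≠ 0) (q : periodDomain 1) :
    (embGL hp)⁻¹ • (q : ℙ ℂ (Fin 6 → ℂ)) ∈ periodDomain (p ^ 2) := by
  rw [← embGL_smul_mem_iff hp, smul_inv_smul]
  exact q.2

/-- The identification of the period domains. -/
noncomputable def domainHomeomorph (hp : p ≠ 0) : periodDomain 1 ≃ₜ periodDomain (p ^ 2) where
  toFun q := ⟨(embGL hp)⁻¹ • (q : ℙ ℂ (Fin 6 → ℂ)), embGL_inv_smul_mem hp q⟩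
  invFun q := ⟨embGL hp • (q : ℙ ℂ (Fin 6 → ℂ)), (embGL_smul_mem_iff hp _).2 q.2⟩
  left_inv _ := Subtype.ext (smul_inv_smul _ _)
  right_inv _ := Subtype.ext (inv_smul_smul _ _)
  continuous_toFun := ((continuous_const_smul _).comp continuous_subtype_val).subtype_mk _
  continuous_invFun := ((continuous_const_smul _).comp continuous_subtype_val).subtype_mk _

/-- `𝓓_{L_2} → 𝓕_{L_{2p²}}(Γ_{2p²})`. -/
noncomputable def coverProj (hp : p ≠ 0) (q : periodDomain 1) : ModVar (p ^ 2) :=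
  modProj (p ^ 2) (domainHomeomorph hp q)

/-- The elements of the image of `Γ_{2p²}` which preserve the period domain. -/
noncomputable def coverGroup (hp : p ≠ 0) : Subgroup (domainGroup 1) :=
  (gamHom hp).range.comap (Subgroup.inclusion inf_le_left)

theorem mem_coverGroup (hp : p ≠ 0) (h : domainGroup 1) :
    h ∈ coverGroup hp ↔ ∃ g ∈ Gam (p ^ 2), Intertwines p (h : GL (Fin 6) ℤ) g := by
  constructor
  · rintro ⟨g, hg⟩
    refine ⟨g, g.2, ?_⟩
    have := gamHom_intertwines hp g
    rw [hg] at this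
    exact this
  · rintro ⟨g, hg, hhg⟩
    exact ⟨⟨g, hg⟩, Subtype.ext ((gamHom_intertwines hp ⟨g, hg⟩).left_unique hp hhg)⟩

theorem finiteIndex_coverGroup (hp : p.Prime) (hp3 : 3 < p) :
    (coverGroup hp.ne_zero).FiniteIndex := by
  have := (index_range_gamHom hp hp3).1
  refine ⟨?_⟩
  rw [coverGroup, Subgroup.index_comap]
  exact Subgroup.FiniteIndex.index_ne_zero (H := Subgroup.subgroupOf _ _)

theorem Intertwines.toGLC_mul (hp : p ≠ 0) {h g : GL (Fin 6) ℤ} (hg : Intertwines p h g) :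
    toGLC h * embGL hp = embGL hp * toGLC g := by
  refine Units.ext ?_
  change (h : Matrix (Fin 6) (Fin 6) ℤ).map (Int.cast : ℤ → ℂ) * (embMat p).map (Int.cast : ℤ → ℂ) =
    (embMat p).map (Int.cast : ℤ → ℂ) * (g : Matrix (Fin 6) (Fin 6) ℤ).map (Int.cast : ℤ → ℂ)
  rw [← map_intCast_mul, ← map_intCast_mul, hg]

theorem isQuotientBy_coverProj (hp : p ≠ 0) : IsQuotientBy (coverGroup hp) (coverProj hp) where
  isQuotientMap := (isQuotientBy_modProj (p ^ 2)).isQuotientMap.comp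
    (domainHomeomorph hp).isQuotientMap
  eq_iff q r := by
    -- Under the identification of the domains, the action of g becomes that of its conjugate h.
    have key : ∀ {h g : GL (Fin 6) ℤ}, Intertwines p h g →
        (toGLC g • (embGL hp)⁻¹ • (q : ℙ ℂ (Fin 6 → ℂ)) = (embGL hp)⁻¹ • (r : ℙ ℂ (Fin 6 → ℂ)) ↔
          toGLC h • (q : ℙ ℂ (Fin 6 → ℂ)) = r) := by
      intro h g hg
      rw [eq_inv_smul_iff, ← mul_smul, ← mul_smul, ← hg.toGLC_mul hp, mul_assoc,
        mul_inv_cancel, mul_one]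
    refine (Quotient.eq (r := orbitSetoid (p ^ 2))).trans ?_
    constructor
    · rintro ⟨g, hg, h⟩
      obtain ⟨k, hk, hkg⟩ := exists_intertwines_of_mem_Gam hp hg
      have hkq := (key hkg).1 h
      exact ⟨⟨k, mem_domainGroup hk q.2 (by rw [hkq]; exact r.2)⟩,
        (mem_coverGroup hp _).2 ⟨g, hg, hkg⟩, Subtype.ext hkq⟩
    · rintro ⟨k, hk, h⟩
      obtain ⟨g, hg, hkg⟩ := (mem_coverGroup hp k).1 hk
      exact ⟨g, hg, (key hkg).2 (congrArg Subtype.val h)⟩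

/-- The map `𝓕_{L_{2p²}}(Γ_{2p²}) → 𝓕_{L_2}(Γ_2)`. -/
noncomputable def coverMap (hp : p ≠ 0) (y : ModVar (p ^ 2)) : ModVar 1 :=
  modProj 1
    (Function.surjInv (isQuotientBy_coverProj hp).isQuotientMap.surjective y)

/-- Independence of the lift chosen in `coverMap`: two lifts differ by an element of `coverGroup`,
hence of `domainGroup 1`. -/
theorem coverMap_coverProj (hp : p ≠ 0) (q : periodDomain 1) :
    coverMap hp (coverProj hp q) = modProj 1 q := by
  have h := Function.surjInv_eq (isQuotientBy_coverProj hp).isQuotientMap.surjective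
    (coverProj hp q)
  obtain ⟨k, -, hk⟩ := ((isQuotientBy_coverProj hp).eq_iff _ _).1 h
  exact ((isQuotientBy_modProj 1).eq_iff _ _).2 ⟨k, trivial, hk⟩

theorem embC_mem_periodDomain (hp : p ≠ 0) {x : Fin 6 → ℂ} (hx : x ≠ 0)
    (hD : Projectivization.mk ℂ x hx ∈ periodDomain (p ^ 2)) :
    Projectivization.mk ℂ (embC p x) (embC_ne_zero hp hx) ∈ periodDomain 1 := by
  rw [← embGL_smul_mk hp hx, embGL_smul_mem_iff]
  exact hD

theorem pt_eq_coverProj (hp : p ≠ 0) {x : Fin 6 → ℂ} (hx : x ≠ 0)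
    (hD : Projectivization.mk ℂ x hx ∈ periodDomain (p ^ 2)) :
    ModVar.pt (p ^ 2) x hx hD = coverProj hp ⟨_, embC_mem_periodDomain hp hx hD⟩ := by
  refine congrArg (modProj (p ^ 2)) (Subtype.ext ?_)
  exact (inv_smul_smul (embGL hp) (Projectivization.mk ℂ x hx)).symm

theorem coverMap_pt (hp : p ≠ 0) {x : Fin 6 → ℂ} (hx : x ≠ 0)
    (hD : Projectivization.mk ℂ x hx ∈ periodDomain (p ^ 2)) :
    coverMap hp (ModVar.pt (p ^ 2) x hx hD) =
      ModVar.pt 1 (embC p x) (embC_ne_zero hp hx) (embC_mem_periodDomain hp hx hD) := by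
  rw [pt_eq_coverProj hp hx hD, coverMap_coverProj]
  rfl

/-! ### Comparison of holomorphic functions and the branched covering -/

theorem IsHolomorphicOn.mono {d : ℕ} {U U' : Set (ModVar d)} {f : ModVar d → ℂ}
    (hf : IsHolomorphicOn d U f) (h : U' ⊆ U) : IsHolomorphicOn d U' f := by
  intro x hx hD hU
  obtain ⟨W, F, hW, hxW, hF, hFf⟩ := hf x hx hD (h hU)
  exact ⟨W, F, hW, hxW, hF, fun y hy hyD hyW hyU => hFf y hy hyD hyW (h hyU)⟩

theorem isHolomorphicOn_comp_coverMap (hp : p ≠ 0) {U : Set (ModVar 1)} {h : ModVar 1 → ℂ}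
    (hh : IsHolomorphicOn 1 U h) :
    IsHolomorphicOn (p ^ 2) (coverMap hp ⁻¹' U) (h ∘ coverMap hp) := by
  intro x hx hD hU
  rw [Set.mem_preimage, coverMap_pt] at hU
  obtain ⟨W, F, hW, hxW, hF, hFf⟩ := hh _ _ _ hU
  have hdiff : Differentiable ℂ (embC p) := differentiable_mulVec _
  refine ⟨embC p ⁻¹' W, F ∘ embC p, hW.preimage hdiff.continuous, hxW,
    hF.comp hdiff.differentiableOn (Set.mapsTo_preimage _ _), fun y hy hyD hyW hyU => ?_⟩
  rw [Set.mem_preimage, coverMap_pt] at hyU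
  rw [Function.comp_apply, Function.comp_apply, coverMap_pt]
  exact hFf _ _ _ hyW hyU

/-- Over a slice the linear map y ↦ E⁻¹ k y, with k moving the given point into V, is a local
section of the covering on the level of cones. Composing a local extension with it gives one for h.
-/
theorem isHolomorphicOn_of_comp_coverMap (hp : p ≠ 0) {q₀ : periodDomain 1}
    {V : Set (periodDomain 1)} (hV : IsSliceAt (domainGroup 1) q₀ V) {W : Set (ModVar 1)}
    (hW : W ⊆ modProj 1 '' V) {h : ModVar 1 → ℂ}
    (hh : IsHolomorphicOn (p ^ 2) (coverProj hp '' V ∩ coverMap hp ⁻¹' W) (h ∘ coverMap hp)) :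
    IsHolomorphicOn 1 W h := by
  intro x hx hD hU
  obtain ⟨v, hv, hvx⟩ := hW hU
  obtain ⟨k, -, hk⟩ := ((isQuotientBy_modProj 1).eq_iff _ _).1 hvx.symm
  obtain ⟨W₀, hW₀, hW₀O⟩ := exists_isOpen_cone (hV.isOpen.preimage (continuous_const_smul k))
  let A : (Fin 6 → ℂ) → Fin 6 → ℂ := fun y => embInvC p (actC (k : GL (Fin 6) ℤ) y)
  have hA : Differentiable ℂ A := (differentiable_mulVec _).comp (differentiable_actC _)
  have hA0 : ∀ {y : Fin 6 → ℂ}, y ≠ 0 → A y ≠ 0 := fun hy => embInvC_ne_zero hp (actC_ne_zero hy)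
  have hAmk : ∀ {y : Fin 6 → ℂ} (hy : y ≠ 0) (hyD : Projectivization.mk ℂ y hy ∈ periodDomain 1),
      Projectivization.mk ℂ (A y) (hA0 hy) =
        domainHomeomorph hp (k • (⟨_, hyD⟩ : periodDomain 1)) := fun hy hyD => rfl
  have hAD : ∀ {y : Fin 6 → ℂ} (hy : y ≠ 0) (_ : Projectivization.mk ℂ y hy ∈ periodDomain 1),
      Projectivization.mk ℂ (A y) (hA0 hy) ∈ periodDomain (p ^ 2) := fun hy hyD => by
    rw [hAmk hy hyD]; exact Subtype.coe_prop _
  have hpt : ∀ {y : Fin 6 → ℂ} (hy : y ≠ 0) (hyD : Projectivization.mk ℂ y hy ∈ periodDomain 1),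
      ModVar.pt (p ^ 2) (A y) (hA0 hy) (hAD hy hyD) =
        coverProj hp (k • (⟨_, hyD⟩ : periodDomain 1)) := fun hy hyD => rfl
  have hfpt : ∀ {y : Fin 6 → ℂ} (hy : y ≠ 0) (hyD : Projectivization.mk ℂ y hy ∈ periodDomain 1),
      coverMap hp (ModVar.pt (p ^ 2) (A y) (hA0 hy) (hAD hy hyD)) = ModVar.pt 1 y hy hyD :=
    fun hy hyD => by
      rw [hpt, coverMap_coverProj]
      exact (((isQuotientBy_modProj 1).eq_iff _ _).2 ⟨k, trivial, rfl⟩).symm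
  have hmem : ∀ {y : Fin 6 → ℂ} (hy : y ≠ 0) (hyD : Projectivization.mk ℂ y hy ∈ periodDomain 1),
      k • (⟨_, hyD⟩ : periodDomain 1) ∈ V → ModVar.pt 1 y hy hyD ∈ W →
      ModVar.pt (p ^ 2) (A y) (hA0 hy) (hAD hy hyD) ∈ coverProj hp '' V ∩ coverMap hp ⁻¹' W :=
    fun hy hyD hkV hyW => ⟨⟨_, hkV, (hpt hy hyD).symm⟩, by
      rw [Set.mem_preimage, hfpt]; exact hyW⟩
  have hxV : k • (⟨_, hD⟩ : periodDomain 1) ∈ V := by rw [hk]; exact hv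
  obtain ⟨W₁, F, hW₁, hxW₁, hF, hFf⟩ := hh _ _ _ (hmem hx hD hxV hU)
  refine ⟨A ⁻¹' W₁ ∩ W₀, F ∘ A, (hW₁.preimage hA.continuous).inter hW₀,
    ⟨hxW₁, (hW₀O x hx hD).2 hxV⟩,
    hF.comp hA.differentiableOn fun y hy => hy.1, fun y hy hyD hyW hyU => ?_⟩
  rw [Function.comp_apply, hFf _ (hA0 hy) (hAD hy hyD) hyW.1
    (hmem hy hyD ((hW₀O y hy hyD).1 hyW.2) hyU), Function.comp_apply, hfpt]

theorem isFiniteBranchedCovering_coverMap (hp : p.Prime) (hp3 : 3 < p) :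
    IsFiniteBranchedCovering (IsHolomorphicOn (p ^ 2)) (IsHolomorphicOn 1)
      (coverMap hp.ne_zero) := by
  have hfin := finiteIndex_coverGroup hp hp3
  have hπ := isQuotientBy_modProj 1
  have hπ' := isQuotientBy_coverProj hp.ne_zero
  have hf := coverMap_coverProj hp.ne_zero
  have hG := isLocallyFiniteAction_domainGroup one_pos
  have hcl := isClosed_ramification hG
  have hint := interior_ramification hG interior_fixed_eq_empty
  set T := modProj 1 ''
    ramification (domainGroup 1) (periodDomain 1) with hT
  have hpreT : modProj 1 ⁻¹' T =
      ramification (domainGroup 1) (periodDomain 1) := preimage_image_ramification hπ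
  have hTcl : IsClosed T := by
    rw [← hπ.isQuotientMap.isClosed_preimage, hpreT]
    exact hcl
  -- Both T and its preimage in the covering pull back to the same ramification set in 𝓓, which has
  -- empty interior, so one argument treats both.
  have hnd : ∀ {Z : Type} [TopologicalSpace Z] (ρ : periodDomain 1 → Z) (C : Set Z),
      Continuous ρ → Function.Surjective ρ → IsClosed C →
      ρ ⁻¹' C = ramification (domainGroup 1) (periodDomain 1) → IsNowhereDense C := by
    intro Z _ ρ C hρ hsurj hC hpre
    rw [hC.isNowhereDense_iff, Set.eq_empty_iff_forall_notMem]
    intro z hz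
    obtain ⟨q, rfl⟩ := hsurj z
    have : q ∈ interior (ramification (domainGroup 1) (periodDomain 1)) := by
      rw [← hpre]
      exact preimage_interior_subset_interior_preimage hρ hz
    rw [hint] at this
    exact this
  have hfc := continuous_of_quotients hπ hπ' hf
  refine ⟨isProperMap_of_quotients hπ hπ' hf, finite_fibre_of_quotients hπ hπ' hf,
    surjective_of_quotients hπ hf, fun U h _ hh => isHolomorphicOn_comp_coverMap hp.ne_zero hh,
    T, isAnalyticSubset_ramification one_pos,
    hnd _ T hπ.isQuotientMap.continuous hπ.isQuotientMap.surjective hTcl hpreT,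
    hnd _ _ hπ'.isQuotientMap.continuous hπ'.isQuotientMap.surjective (hTcl.preimage hfc) ?_,
    isCoveringMapOn_of_quotients hG hπ hπ' hf, ?_⟩
  · rw [← hpreT, ← Set.preimage_comp]
    congr 1
    exact funext hf
  · intro y hy
    obtain ⟨q, rfl⟩ := hπ'.isQuotientMap.surjective y
    rw [hf] at hy
    have hq : q ∉ ramification (domainGroup 1) (periodDomain 1) := fun h => hy ⟨q, h, rfl⟩
    obtain ⟨V, -, hV⟩ := hG.exists_isSliceAt q isOpen_univ trivial
    obtain ⟨e, hes, het, hef⟩ := exists_openPartialHomeomorph hπ hπ' hf hV hq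
    refine ⟨e, hes ▸ Set.mem_image_of_mem _ hV.mem, fun z _ => (hef z).symm, fun W _ hWt h => ?_⟩
    rw [hes]
    rw [het] at hWt
    exact ⟨fun hh => (isHolomorphicOn_comp_coverMap hp.ne_zero hh).mono Set.inter_subset_right,
      fun hh => isHolomorphicOn_of_comp_coverMap hp.ne_zero hV hWt hh⟩

end Covering

end OrthogonalModular

theorem proposition2p4 (p : ℕ) (hp : p.Prime) (hp3 : 3 < p) :
    -- `Γ_{2p²}` is a subgroup of `Γ_2` through the embedding of lattices `L_{2p²} → L_2`
    (∃ φ : OrthogonalModular.Gam (p ^ 2) →* OrthogonalModular.Gam 1,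
      Function.Injective φ ∧
      (∀ (g : OrthogonalModular.Gam (p ^ 2)) (x : Fin 6 → ℤ),
        ((φ g : GL (Fin 6) ℤ) : Matrix (Fin 6) (Fin 6) ℤ) *ᵥ (OrthogonalModular.embMat p *ᵥ x) =
          OrthogonalModular.embMat p *ᵥ (((g : GL (Fin 6) ℤ) : Matrix (Fin 6) (Fin 6) ℤ) *ᵥ x)) ∧
      -- whose index is finite and bounded
      φ.range.FiniteIndex ∧ φ.range.index ≤ 2 * (p ^ 5 + p ^ 2)) ∧
    -- the map of modular varieties induced by the embedding is a finite branched covering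
    (∃ f : OrthogonalModular.ModVar (p ^ 2) → OrthogonalModular.ModVar 1,
      (∀ (x : Fin 6 → ℂ) (hx : x ≠ 0)
        (hD : Projectivization.mk ℂ x hx ∈ OrthogonalModular.periodDomain (p ^ 2)),
        ∃ (hx' : (OrthogonalModular.embMat p).map (Int.cast : ℤ → ℂ) *ᵥ x ≠ 0)
          (hD' : Projectivization.mk ℂ _ hx' ∈ OrthogonalModular.periodDomain 1),
          f (OrthogonalModular.ModVar.pt (p ^ 2) x hx hD) =
            OrthogonalModular.ModVar.pt 1 _ hx' hD') ∧
      OrthogonalModular.IsFiniteBranchedCovering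
        (OrthogonalModular.IsHolomorphicOn (p ^ 2)) (OrthogonalModular.IsHolomorphicOn 1) f) := by
  refine ⟨⟨OrthogonalModular.gamHom hp.ne_zero, OrthogonalModular.gamHom_injective hp.ne_zero,
    fun g x => ?_, (OrthogonalModular.index_range_gamHom hp hp3).1, ?_⟩,
    OrthogonalModular.coverMap hp.ne_zero, fun x hx hD =>
      ⟨OrthogonalModular.embC_ne_zero hp.ne_zero hx,
        OrthogonalModular.embC_mem_periodDomain hp.ne_zero hx hD,
        OrthogonalModular.coverMap_pt hp.ne_zero hx hD⟩,
    OrthogonalModular.isFiniteBranchedCovering_coverMap hp hp3⟩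
  · rw [Matrix.mulVec_mulVec, Matrix.mulVec_mulVec, OrthogonalModular.gamHom_intertwines]
  · exact (OrthogonalModular.index_range_gamHom hp hp3).2.trans (by omega)
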